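/- Let $[n]=\{1,\dots,n\}$, let $\mathfrak S_n$ be the set of permutations of $[n]$, and let an automaton on $[n]$ be a pair $A$ of functions $a,b:[n]\to[n]$. Let $\mathcal A$ be the set of automata on $[n]$ and let $\mathcal A^{\bullet\diamond}=\mathcal A\times[n]\times\mathfrak S_n$. Let $w=w^1\cdots w^k$ be a word of length $k\ge1$ over $\{a,b\}$, with indices of letters read modulo $k$; it is self-conjugate if it equals one of its nontrivial cyclic rotations. For $u\in[n]$ and $r\in\mathbb Z/k$, put $u_0=u$ and $u_{i+1}=w^{r+i+1}(u_i)$ for $i\ge 0$. Let $T$ be the least $j\ge1$ for which there is $i<j$ with $u_i=u_j$ and $i\equiv j \pmod k$, and let $\tilde T$ be this $i$ for $j=T$. The $w$-thread of $(u,r)$ is the sequence $((u_i,r+i))_{0\le i\le T-1}$ in $[n]\times\mathbb Z/k$. Let $A_w:[n]\to[n]$ be the map obtained by applying $w^1,w^2,\dots,w^k$ successively; $A$ is a $w$-tree if $A_w$ has exactly one cyclic point, i.e. exactly one $v$ with $A_w^m(v)=v$ for some $m\ge1$. If $A$ is a $w$-tree and $v\in[n]$, then $(A,v)$ is $0$-shifted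 if the length $T$ of the $w$-thread of $(v,0)$ is divisible by $k$. Given $(A,v,\sigma)\in\mathcal A^{\bullet\diamond}$, let $(u_i)$, $T$, $\tilde T$ be as above for $(v,0)$, let $\mathbf b_1,\dots,\mathbf b_\ell$ be the vertices $u_{ki}$, $0\le i\le\lfloor\tilde T/k\rfloor$, for which $\sigma(u_{ki})<\sigma(u_{kj})$ for all $0\le j<i$, and let $\mathbf b_{\ell+1}=u_{\tilde T}$. Call $(A,v,\sigma)$ branch-good if, for all $p,q\in\{1,\dots,\ell+1\}$ and $r,s\in\mathbb Z/k$, whenever $(\mathbf b_q,s)$ appears in the $w$-thread of $(\mathbf b_p,r)$ at a position other than the starting one, then $s=0$. Let $\widehat{\mathcal B}_w$ be the set of branch-good $(A,v,\sigma)\in\mathcal A^{\bullet\diamond}$ such that $A$ is a $w$-tree and $(A,v)$ is $0$-shifted. Then, as $n\to\infty$, uniformly over all $1\le k\le 2\log_2 n$ and all words $w$ of length $k$ that are not self-conjugate, $$|\widehat{\mathcal B}_w|\sim\frac{|\mathcal A^{\bullet\diamond}|}{n}.$$ Equivalently, a uniformly random element of $\mathcal A^{\bullet\diamond}$ lies in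 $\widehat{\mathcal B}_w$ with probability asymptotic to $1/n$, uniformly in $k$ and $w$ as above. -/

import Mathlib

/-- The alphabet `{a, b}`: `false` stands for `a` and `true` for `b`. -/
abbrev Letter : Type := Bool

/-- An automaton on the vertex set `[n]`: one transition function for each letter. -/
abbrev Automaton (n : ℕ) : Type := Letter → Fin n → Fin n

/-- The set `𝒜^{•◇} = 𝒜 × [n] × 𝔖ₙ` of automata with a marked vertex and a labelling. -/
abbrev MarkedLabelledAutomaton (n : ℕ) : Type := Automaton n × Fin n × Equiv.Perm (Fin n)

/-- A word `w = w¹w²…wᵏ` of length `k ≥ 1`. Its letters are indexed by the integers modulo `k`: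
the first letter is `w 1`, the second one is `w 2`, and the last one is `w k = w 0`. -/
abbrev Word (k : ℕ) : Type := ZMod k → Letter

/-- A word is self-conjugate if a nontrivial cyclic rotation fixes it. -/
def IsSelfConjugate {k : ℕ} (w : Word k) : Prop :=
  ∃ c : ZMod k, c ≠ 0 ∧ ∀ j : ZMod k, w (j + c) = w j

/-- The vertices `u₀ = u, u₁, u₂, …` of the infinite sequence of transitions that starts at `u`
with congruence `r`: the step from `uᵢ` to `uᵢ₊₁` reads the letter `w^{r+i+1}`. -/
def walk {n k : ℕ} (A : Automaton n) (w : Word k) (u : Fin n) (r : ZMod k) : ℕ → Fin n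
  | 0 => u
  | i + 1 => A (w (r + (i : ZMod k) + 1)) (walk A w u r i)

/-- The first time `T` at which a pair (vertex, time modulo `k`) is repeated in the walk.
For `k ≥ 1` such a time exists by the pigeonhole principle. -/
noncomputable def threadLength {n k : ℕ} (A : Automaton n) (w : Word k)
    (u : Fin n) (r : ZMod k) : ℕ :=
  sInf {j : ℕ | 1 ≤ j ∧ ∃ i < j, walk A w u r i = walk A w u r j ∧ i ≡ j [MOD k]}

/-- The time `T̃`: the unique `i < T` with `uᵢ = u_T` and `i ≡ T` modulo `k`. -/
noncomputable def tailLength {n k : ℕ} (A : Automaton n) (w : Word k)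
    (u : Fin n) (r : ZMod k) : ℕ :=
  sInf {i : ℕ | i < threadLength A w u r ∧
    walk A w u r i = walk A w u r (threadLength A w u r) ∧ i ≡ threadLength A w u r [MOD k]}

/-- The `w`-thread of `(u, r)`: the list of the pairs `(uᵢ, r + i)` for `0 ≤ i ≤ T - 1`. -/
noncomputable def thread {n k : ℕ} (A : Automaton n) (w : Word k)
    (u : Fin n) (r : ZMod k) : List (Fin n × ZMod k) :=
  (List.range (threadLength A w u r)).map fun i => (walk A w u r i, r + (i : ZMod k))

/-- `(u, r) →^w (v, s)`: the pair `(v, s)` appears in the `w`-thread of `(u, r)`. -/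
def Reaches {n k : ℕ} (A : Automaton n) (w : Word k)
    (u : Fin n) (r : ZMod k) (v : Fin n) (s : ZMod k) : Prop :=
  (v, s) ∈ thread A w u r

/-- The one-letter automaton `A_w` of the `w`-transitions of `A`. -/
def inducedMap {n k : ℕ} (A : Automaton n) (w : Word k) : Fin n → Fin n :=
  fun u => walk A w u 0 k

/-- `A` is a `w`-tree: `A_w` has a unique cyclic point. -/
def IsWTree {n k : ℕ} (A : Automaton n) (w : Word k) : Prop :=
  ∃! v : Fin n, v ∈ Function.periodicPts (inducedMap A w)

/-- `(A, v)` is `r`-shifted: `A` is a `w`-tree and the length `T` of the `w`-thread of `(v, 0)`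
is congruent to `r` modulo `k`. -/
def IsShifted {n k : ℕ} (A : Automaton n) (w : Word k) (v : Fin n) (r : ZMod k) : Prop :=
  IsWTree A w ∧ (threadLength A w v 0 : ZMod k) = r

/-- The `i` with `0 ≤ i ≤ ⌊T̃ / k⌋` such that `i` is a (strict) lower record of the sequence
`i ↦ σ(u_{ki})` along the `w`-thread of `(v, 0)`, in increasing order. -/
noncomputable def lowerRecords {n k : ℕ} (A : Automaton n) (w : Word k)
    (v : Fin n) (σ : Equiv.Perm (Fin n)) : List ℕ :=
  (List.range (tailLength A w v 0 / k + 1)).filter fun i =>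
    decide (∀ j < i, σ (walk A w v 0 (k * i)) < σ (walk A w v 0 (k * j)))

/-- The vertices `b₁, …, b_ℓ, b_{ℓ+1}`: the vertices that realize the lower records along the
branch of `v`, followed by the vertex `u_{T̃}` at which the thread becomes periodic. -/
noncomputable def branchVertices {n k : ℕ} (A : Automaton n) (w : Word k)
    (v : Fin n) (σ : Equiv.Perm (Fin n)) : List (Fin n) :=
  (lowerRecords A w v σ).map (fun i => walk A w v 0 (k * i)) ++
    [walk A w v 0 (tailLength A w v 0)]

/-- `(A, v, σ)` is branch-good: whenever `(b_p, r) →^w (b_q, s)`, then `s = 0`. The appearance of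
`(b_p, r)` as the starting pair of its own thread is not counted. -/
def IsBranchGood {n k : ℕ} (A : Automaton n) (w : Word k)
    (v : Fin n) (σ : Equiv.Perm (Fin n)) : Prop :=
  ∀ x ∈ branchVertices A w v σ, ∀ y ∈ branchVertices A w v σ, ∀ r s : ZMod k,
    (y, s) ≠ (x, r) → Reaches A w x r y s → s = 0

/-- The set of the labelled marked `w`-trees on `[n]` that are `0`-shifted and branch-good. -/
def goodMarkedTrees (n : ℕ) {k : ℕ} (w : Word k) : Set (MarkedLabelledAutomaton n) :=
  {x | IsBranchGood x.1 w x.2.1 x.2.2 ∧ IsWTree x.1 w ∧ IsShifted x.1 w x.2.1 0}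

/-- The uniform probability of a set `S` of labelled marked automata. -/
noncomputable def uniformProb {n : ℕ} (S : Set (MarkedLabelledAutomaton n)) : ℝ :=
  (S.ncard : ℝ) / (Nat.card (MarkedLabelledAutomaton n) : ℝ)

/-! Since `|𝒜^{•◇}| / n = |𝒜| · n!`, good triples `(A, v, σ)` have to be compared with pairs `(A',
σ)`; the mark is absorbed as in Joyal's proof of Cayley's formula. In a `0`-shifted marked `w`-tree
the `A_w`-orbit of `v` is a path `c 0 = v, …, c t` that ends at the fixed point of `A_w`. Cutting
this path before each strict lower record of the labels and closing each block into a cycle gives a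
permutation of the `c i`, and by Foata's correspondence this permutation and `σ` determine the path.
Conversely, the cycles, each started at its smallest label and listed by decreasing minima,
concatenate to a path.

The obstacle is that a `w`-transition uses `k` transitions of the automaton, so changing one
transition may alter many `w`-transitions. Only the last letter at block ends is redirected, and its
old and new ends lie in the set `S` of record vertices together with `c t`. If walks from `S` come
back to `S` only at congruence `0`, a walk from `S` can use a redirected transition only as the last
letter of `w`, and this property survives redirection (`ReturnsAtZero.of_agreeOutside`).
Branch-goodness provides it for trees, `cycleGood` for automata. Thus `exists_cut` yields the upper
bound `|𝒜| · n!`, valid without any asymptotics, and `exists_glue` injects `cycleGood` into the good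
trees.

It remains to see that `cycleGood` has proportion `1 - o(1)`, by a first moment bound. Suppose a
special vertex is reached from a special vertex at congruence `s ≠ 0`. Compare this walk with the
cycle of its target, backwards from the target: `k` common transitions would make `w` invariant
under the shift by `s`. So, apart from short walks that `exists_config` rules out, two different
transitions enter one vertex near the target. With the closing of the cycle this prescribes two
transition ends, a factor `n⁻²` against `n` choices of base vertex; if a second cycle is involved,
it is `n⁻³` against `n²`. A prescribed vertex carries the smallest label of a cycle of length `L`
with probability at most `1 / L`, which turns the sum over closing times into a harmonic sum. One
free time up to `M` remains, so the bound is `M / n` up to powers of `k` and `log M`, once all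
threads have length at most `M`. Fresh transitions close a long walk quickly
(`card_noRepetition_le`), so `M` of order `k² n^{2/3}` suffices, and `k ≤ 2 log₂ n` absorbs the
powers of `k`. -/

/-! ### The exploded transition system -/

/-- The exploded transition system: one transition on pairs (vertex, congruence). -/
def explode {n k : ℕ} (A : Automaton n) (w : Word k) (o : Fin n × ZMod k) : Fin n × ZMod k :=
  (A (w (o.2 + 1)) o.1, o.2 + 1)

lemma explode_iterate {n k : ℕ} (A : Automaton n) (w : Word k) (u : Fin n) (r : ZMod k) (i : ℕ) :
    (explode A w)^[i] (u, r) = (walk A w u r i, r + i) := by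
  induction i with
  | zero => simp [walk]
  | succ i ih =>
    rw [Function.iterate_succ_apply', ih]
    simp [explode, walk, add_assoc]

lemma walk_eq_iterate {n k : ℕ} (A : Automaton n) (w : Word k) (u : Fin n) (r : ZMod k) (i : ℕ) :
    walk A w u r i = ((explode A w)^[i] (u, r)).1 := by
  rw [explode_iterate]

lemma walk_succ {n k : ℕ} (A : Automaton n) (w : Word k) (u : Fin n) (r : ZMod k) (i : ℕ) :
    walk A w u r (i + 1) = A (w (r + (i : ZMod k) + 1)) (walk A w u r i) := rfl

lemma explode_iterate_mul {n k : ℕ} (A : Automaton n) (w : Word k) (u : Fin n) (i : ℕ) :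
    (explode A w)^[k * i] (u, 0) = ((inducedMap A w)^[i] u, 0) := by
  rw [Function.iterate_mul]
  induction i with
  | zero => rfl
  | succ i ih =>
    rw [Function.iterate_succ_apply', ih, Function.iterate_succ_apply', explode_iterate]
    simp [inducedMap]

lemma walk_mul {n k : ℕ} (A : Automaton n) (w : Word k) (u : Fin n) (i : ℕ) :
    walk A w u 0 (k * i) = (inducedMap A w)^[i] u := by
  rw [walk_eq_iterate, explode_iterate_mul]

lemma explode_iterate_eq_iff {n k : ℕ} (A : Automaton n) (w : Word k) (u : Fin n) (r : ZMod k)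
    (i j : ℕ) : (explode A w)^[i] (u, r) = (explode A w)^[j] (u, r) ↔
      walk A w u r i = walk A w u r j ∧ i ≡ j [MOD k] := by
  rw [explode_iterate, explode_iterate, Prod.mk.injEq, add_right_inj, ZMod.natCast_eq_natCast_iff]

lemma periodic_explode_iff {n k : ℕ} [NeZero k] (A : Automaton n) (w : Word k) (u : Fin n) :
    (u, (0 : ZMod k)) ∈ Function.periodicPts (explode A w) ↔
      u ∈ Function.periodicPts (inducedMap A w) := by
  constructor
  · rintro ⟨p, hp, h⟩
    refine ⟨p, hp, ?_⟩
    have h1 : (explode A w)^[k * p] (u, 0) = (u, 0) := by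
      have := (h.const_mul k)
      exact this
    rw [explode_iterate_mul] at h1
    exact (Prod.mk.inj h1).1
  · rintro ⟨p, hp, h⟩
    refine ⟨k * p, Nat.mul_pos (NeZero.pos k) hp, ?_⟩
    change (explode A w)^[k * p] (u, 0) = (u, 0)
    rw [explode_iterate_mul, h]

lemma dvd_of_isPeriodicPt {n k : ℕ} (A : Automaton n) (w : Word k) {o : Fin n × ZMod k} {p : ℕ}
    (h : Function.IsPeriodicPt (explode A w) p o) : k ∣ p := by
  have h1 : (explode A w)^[p] (o.1, o.2) = o := h
  rw [explode_iterate] at h1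
  have h2 := congrArg Prod.snd h1
  simp only [add_eq_left] at h2
  exact (ZMod.natCast_eq_zero_iff p k).1 h2

/-! ### Threads -/

section Threads

variable {n k : ℕ} (A : Automaton n) (w : Word k) (u : Fin n) (r : ZMod k)

lemma threadLength_eq : threadLength A w u r = sInf {j : ℕ | 1 ≤ j ∧ ∃ i < j,
    (explode A w)^[i] (u, r) = (explode A w)^[j] (u, r)} := by
  simp only [threadLength, explode_iterate_eq_iff]

lemma reaches_iff {A : Automaton n} {w : Word k} {u : Fin n} {r : ZMod k} {v : Fin n} {s : ZMod k} :
    Reaches A w u r v s ↔ ∃ j < threadLength A w u r, (explode A w)^[j] (u, r) = (v, s) := by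
  simp [Reaches, thread, explode_iterate]

lemma iterate_injOn_threadLength {i j : ℕ} (hi : i < threadLength A w u r)
    (hj : j < threadLength A w u r)
    (h : (explode A w)^[i] (u, r) = (explode A w)^[j] (u, r)) : i = j := by
  by_contra hne
  rw [threadLength_eq] at hi hj
  rcases lt_or_gt_of_ne hne with h' | h'
  · exact Nat.notMem_of_lt_sInf hj ⟨by omega, i, h', h⟩
  · exact Nat.notMem_of_lt_sInf hi ⟨by omega, j, h', h.symm⟩

variable [NeZero k]

lemma threadLength_mem : 1 ≤ threadLength A w u r ∧ ∃ i < threadLength A w u r,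
    (explode A w)^[i] (u, r) = (explode A w)^[threadLength A w u r] (u, r) := by
  rw [threadLength_eq]
  apply Nat.sInf_mem
    (s := {j : ℕ | 1 ≤ j ∧ ∃ i < j, (explode A w)^[i] (u, r) = (explode A w)^[j] (u, r)})
  obtain ⟨i, j, hij, h⟩ := Finite.exists_ne_map_eq_of_infinite
    fun i : ℕ => (explode A w)^[i] (u, r)
  rcases lt_or_gt_of_ne hij with h' | h'
  · exact ⟨j, by omega, i, h', h⟩
  · exact ⟨i, by omega, j, h', h.symm⟩

lemma tailLength_spec : tailLength A w u r < threadLength A w u r ∧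
    (explode A w)^[tailLength A w u r] (u, r) = (explode A w)^[threadLength A w u r] (u, r) := by
  have h := (threadLength_mem A w u r).2
  simp only [explode_iterate_eq_iff] at h ⊢
  exact Nat.sInf_mem (s := {i : ℕ | i < threadLength A w u r ∧
    walk A w u r i = walk A w u r (threadLength A w u r) ∧ i ≡ threadLength A w u r [MOD k]}) h

lemma threadLength_unique {t T : ℕ} (htT : t < T)
    (h : (explode A w)^[t] (u, r) = (explode A w)^[T] (u, r))
    (hinj : ∀ i < T, ∀ j < T, (explode A w)^[i] (u, r) = (explode A w)^[j] (u, r) → i = j) :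
    threadLength A w u r = T ∧ tailLength A w u r = t := by
  have h1 : threadLength A w u r = T := by
    apply le_antisymm
    · rw [threadLength_eq]
      exact Nat.sInf_le ⟨by omega, t, htT, h⟩
    · by_contra hlt
      push Not at hlt
      obtain ⟨-, i, hi, h2⟩ := threadLength_mem A w u r
      have := hinj _ (hi.trans hlt) _ hlt h2
      omega
  refine ⟨h1, ?_⟩
  obtain ⟨h2, h3⟩ := tailLength_spec A w u r
  rw [h1] at h2 h3
  exact hinj _ h2 _ htT (h3.trans h.symm)

variable {A w u r}

/-- A time past the end of the thread can be lowered by `T - T̃` without changing the node, so the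
truncation of the thread loses no reachable node. -/
lemma reaches_of_iterate {v : Fin n} {s : ZMod k} {j : ℕ}
    (h : (explode A w)^[j] (u, r) = (v, s)) : Reaches A w u r v s := by
  rw [reaches_iff]
  induction j using Nat.strong_induction_on with
  | _ j ih =>
    by_cases hj : j < threadLength A w u r
    · exact ⟨j, hj, h⟩
    · push Not at hj
      obtain ⟨h2, h3⟩ := tailLength_spec A w u r
      refine ih (j - threadLength A w u r + tailLength A w u r) (by omega) ?_
      rw [Function.iterate_add_apply, h3, ← Function.iterate_add_apply, Nat.sub_add_cancel hj, h]

end Threads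

/-! ### Foata's correspondence between orderings and permutations -/

section Foata

variable {α β : Type*} [LinearOrder β]

/-- The index of the (first) minimum of `s 0, …, s i`. -/
def argminUpTo (s : ℕ → β) : ℕ → ℕ
  | 0 => 0
  | i + 1 => if s (i + 1) < s (argminUpTo s i) then i + 1 else argminUpTo s i

/-- The permutation of `{0, …, t}` whose cycles are the intervals that start at the lower records
of `s`. -/
def recordCycle (s : ℕ → β) (t i : ℕ) : ℕ :=
  if i < t ∧ ¬ s (i + 1) < s (argminUpTo s i) then i + 1 else argminUpTo s i

lemma argminUpTo_le (s : ℕ → β) (i : ℕ) : argminUpTo s i ≤ i := by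
  induction i with
  | zero => simp [argminUpTo]
  | succ i ih => rw [argminUpTo]; split_ifs <;> omega

lemma argminUpTo_min (s : ℕ → β) {i j : ℕ} (h : j ≤ i) : s (argminUpTo s i) ≤ s j := by
  induction i with
  | zero => obtain rfl : j = 0 := by omega
            simp [argminUpTo]
  | succ i ih =>
    rw [argminUpTo]
    rcases Nat.lt_or_eq_of_le h with h' | rfl
    · have := ih (by omega)
      split_ifs with h1
      · exact h1.le.trans this
      · exact this
    · split_ifs with h1
      · exact le_rfl
      · exact not_lt.1 h1

lemma lt_of_lt_argminUpTo (s : ℕ → β) {i j : ℕ} (h : j < argminUpTo s i) :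
    s (argminUpTo s i) < s j := by
  induction i with
  | zero => simp [argminUpTo] at h
  | succ i ih =>
    rw [argminUpTo] at h ⊢
    split_ifs at h ⊢ with h1
    · exact h1.trans_le (argminUpTo_min s (by omega))
    · exact ih h

lemma argminUpTo_eq_self_iff (s : ℕ → β) (i : ℕ) : argminUpTo s i = i ↔ ∀ j < i, s i < s j := by
  constructor
  · intro h j hj
    have := lt_of_lt_argminUpTo s (i := i) (j := j) (by omega)
    rwa [h] at this
  · intro h
    by_contra hne
    have h1 := argminUpTo_le s i
    have h2 := h _ (lt_of_le_of_ne h1 hne)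
    exact absurd (argminUpTo_min s (le_refl i)) (not_le.2 h2)

lemma argminUpTo_congr {s s' : ℕ → β} {i : ℕ} (h : ∀ j ≤ i, s j = s' j) :
    argminUpTo s i = argminUpTo s' i := by
  induction i with
  | zero => rfl
  | succ i ih =>
    have h1 := ih fun j hj => h j (by omega)
    have h2 := argminUpTo_le s' i
    simp only [argminUpTo, h1, h (i + 1) le_rfl, h (argminUpTo s' i) (by omega)]

lemma argminUpTo_idem (s : ℕ → β) (i : ℕ) : argminUpTo s (argminUpTo s i) = argminUpTo s i :=
  (argminUpTo_eq_self_iff s _).2 fun _ hj => lt_of_lt_argminUpTo s hj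

lemma succ_record_iff (s : ℕ → β) (i : ℕ) :
    s (i + 1) < s (argminUpTo s i) ↔ argminUpTo s (i + 1) = i + 1 := by
  rw [argminUpTo]
  have := argminUpTo_le s i
  split_ifs with h <;> simp [h]
  omega

lemma recordCycle_le (s : ℕ → β) {t i : ℕ} (h : i ≤ t) : recordCycle s t i ≤ t := by
  rw [recordCycle]
  have := argminUpTo_le s i
  split_ifs <;> omega

/-- A record block is identified by its start `argminUpTo s i`; a forward step inside the block and
the jump back to its start both stay in it. -/
lemma argminUpTo_recordCycle (s : ℕ → β) (t i : ℕ) :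
    argminUpTo s (recordCycle s t i) = argminUpTo s i := by
  rw [recordCycle]
  split_ifs with h
  · rw [argminUpTo, if_neg h.2]
  · exact argminUpTo_idem s i

/-- Equal images lie in one block. A forward step never lands on a record, so it differs from every
jump back. If two ends `i < j` had the same block start, then `i + 1 ≤ j` would carry a label below
the minimum up to `j`. -/
lemma recordCycle_injOn (s : ℕ → β) {t i j : ℕ} (hi : i ≤ t) (hj : j ≤ t)
    (h : recordCycle s t i = recordCycle s t j) : i = j := by
  wlog hij : i ≤ j generalizing i j
  · exact (this hj hi h.symm (by omega)).symm
  have e := congrArg (argminUpTo s) h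
  rw [argminUpTo_recordCycle, argminUpTo_recordCycle] at e
  rw [recordCycle, recordCycle] at h
  have l1 := argminUpTo_le s i
  have l2 := argminUpTo_le s j
  split_ifs at h with h1 h2 h2
  · omega
  · exfalso
    have h3 := argminUpTo_idem s j
    rw [← h] at h3
    exact h1.2 ((succ_record_iff s i).2 h3)
  · exfalso; omega
  · by_contra hne
    have h3 : s (i + 1) < s (argminUpTo s i) := by
      by_contra h4
      exact h1 ⟨by omega, h4⟩
    have := argminUpTo_min s (i := j) (j := i + 1) (by omega)
    rw [← e] at this
    exact absurd h3 (not_lt.2 this)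

/-- `c 0, …, c t` enumerates `P` in such a way that the map `g` is read off from the lower records
of the labels. -/
structure IsFoata (σ : α → β) (g : α → α) (P : Set α) (t : ℕ) (c : ℕ → α) : Prop where
  inj : ∀ i ≤ t, ∀ j ≤ t, c i = c j → i = j
  mem : ∀ x, x ∈ P ↔ ∃ i ≤ t, c i = x
  map : ∀ i ≤ t, g (c i) = c (recordCycle (fun i => σ (c i)) t i)

/-! ### Uniqueness of the enumeration given the map and the labels -/

namespace IsFoata

variable {σ : α → β} {g : α → α} {P : Set α} {t t' : ℕ} {c c' : ℕ → α}

lemma iterate_map (h : IsFoata σ g P t c) {i : ℕ} (hi : i ≤ t) (m : ℕ) :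
    ∃ j ≤ t, g^[m] (c i) = c j ∧
      argminUpTo (fun i => σ (c i)) j = argminUpTo (fun i => σ (c i)) i := by
  induction m with
  | zero => exact ⟨i, hi, rfl, rfl⟩
  | succ m ih =>
    obtain ⟨j, hj, h1, h2⟩ := ih
    refine ⟨_, recordCycle_le (fun i => σ (c i)) hj, ?_, ?_⟩
    · rw [Function.iterate_succ_apply', h1, h.map j hj]
    · rw [argminUpTo_recordCycle, h2]

/-- The orbit of `c i` stays in its block, whose start has the smallest label there: records are the
minima of the cycles. -/
lemma le_of_iterate (h : IsFoata σ g P t c) {i : ℕ} (hi : i ≤ t) (m : ℕ)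
    (hrec : argminUpTo (fun i => σ (c i)) i = i) : σ (c i) ≤ σ (g^[m] (c i)) := by
  obtain ⟨j, hj, h1, h2⟩ := h.iterate_map hi m
  rw [h1]
  have := argminUpTo_min (fun i => σ (c i)) (le_refl j)
  rwa [h2, hrec] at this

lemma iterate_argmin (h : IsFoata σ g P t c) {i : ℕ} (hi : i ≤ t) :
    ∃ m, g^[m] (c (argminUpTo (fun i => σ (c i)) i)) = c i := by
  induction i with
  | zero => exact ⟨0, rfl⟩
  | succ i ih =>
    obtain ⟨m, hm⟩ := ih (by omega)
    by_cases h1 : σ (c (i + 1)) < σ (c (argminUpTo (fun i => σ (c i)) i))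
    · refine ⟨0, ?_⟩
      rw [argminUpTo, if_pos h1]
      rfl
    · refine ⟨m + 1, ?_⟩
      rw [argminUpTo, if_neg h1, Function.iterate_succ_apply', hm, h.map i (by omega),
        recordCycle, if_pos ⟨by omega, h1⟩]

/-- The vertex `c' i` occurs in `c` at some `j ≥ i`, in a block starting at `a` with `σ (c a) ≤ σ (c
i)`. As `c a` leads to `c' i` under `g`, it lies in the block of `c'` that starts with `c' i`, so `σ
(c' i) ≤ σ (c a)`. -/
lemma record_le (h : IsFoata σ g P t c) (h' : IsFoata σ g P t' c')
    {i : ℕ} (hi' : i ≤ t') (hagree : ∀ j < i, c j = c' j)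
    (hr : argminUpTo (fun i => σ (c i)) i = i) (hr' : argminUpTo (fun i => σ (c' i)) i = i) :
    σ (c' i) ≤ σ (c i) := by
  obtain ⟨j, hj, hcj⟩ := (h.mem (c' i)).1 ((h'.mem _).2 ⟨i, hi', rfl⟩)
  have hij : i ≤ j := by
    by_contra hlt
    push Not at hlt
    rw [hagree j hlt] at hcj
    have := h'.inj _ (by omega) _ hi' hcj
    omega
  set a := argminUpTo (fun i => σ (c i)) j with ha
  obtain ⟨m, hm⟩ := h.iterate_argmin hj
  have haj : a ≤ j := argminUpTo_le _ j
  obtain ⟨b, hb, hcb⟩ := (h'.mem (c a)).1 ((h.mem _).2 ⟨a, haj.trans hj, rfl⟩)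
  rw [← ha, ← hcb, hcj] at hm
  obtain ⟨b', hb', h1, h2⟩ := h'.iterate_map hb m
  have h3 : i = b' := h'.inj _ hi' _ hb' (hm.symm.trans h1)
  rw [← h3, hr'] at h2
  have h4 : σ (c' i) ≤ σ (c' b) := by
    have := argminUpTo_min (fun i => σ (c' i)) (le_refl b)
    rwa [← h2] at this
  have h5 : σ (c a) ≤ σ (c i) := argminUpTo_min (fun i => σ (c i)) hij
  rw [hcb] at h4
  exact h4.trans h5

/-- If `i + 1` starts a block of `c` but not of `c'`, then `g` sends the common vertex `c i = c' i`
both to an earlier vertex and to `c' (i + 1)`, against injectivity. -/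
lemma record_of_record (h : IsFoata σ g P t c) (h' : IsFoata σ g P t' c')
    {i : ℕ} (hi : i ≤ t) (hi' : i ≤ t') (hagree : ∀ j < i, c j = c' j)
    (hr : argminUpTo (fun i => σ (c i)) i = i) : argminUpTo (fun i => σ (c' i)) i = i := by
  cases i with
  | zero => rfl
  | succ i =>
    by_contra hne
    rw [← succ_record_iff] at hne hr
    have h1 := h'.map i (by omega)
    rw [recordCycle, if_pos ⟨by omega, hne⟩, ← hagree i (by omega), h.map i (by omega), recordCycle,
      if_neg (fun hh => hh.2 hr), hagree _ (by have := argminUpTo_le (fun i => σ (c i)) i; omega)]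
      at h1
    have h2 := argminUpTo_le (fun i => σ (c i)) i
    have := h'.inj _ (by omega) _ hi' h1
    omega

/-- Inductively, both sequences have a record at `i` or neither has. Records agree by comparing
labels both ways; a non-record is the `g`-image of its predecessor. -/
lemma eq_of_le (hσ : Function.Injective σ) (h : IsFoata σ g P t c) (h' : IsFoata σ g P t' c')
    (i : ℕ) (hi : i ≤ t) (hi' : i ≤ t') : c i = c' i := by
  induction i using Nat.strong_induction_on with
  | _ i ih =>
    have hagree : ∀ j < i, c j = c' j := fun j hj => ih j hj (by omega) (by omega)
    by_cases hr : argminUpTo (fun i => σ (c i)) i = i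
    · have hr' := h.record_of_record h' hi hi' hagree hr
      exact hσ (le_antisymm
        (record_le h' h hi (fun j hj => (hagree j hj).symm) hr' hr)
        (record_le h h' hi' hagree hr hr'))
    · have hr' : argminUpTo (fun i => σ (c' i)) i ≠ i := fun hr' =>
        hr (h'.record_of_record h hi' hi (fun j hj => (hagree j hj).symm) hr')
      cases i with
      | zero => exact absurd rfl hr
      | succ i =>
        rw [← succ_record_iff] at hr
        rw [ne_eq, ← succ_record_iff] at hr'
        have h1 := h.map i (by omega)
        have h2 := h'.map i (by omega)
        rw [recordCycle, if_pos ⟨by omega, hr⟩] at h1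
        rw [recordCycle, if_pos ⟨by omega, hr'⟩] at h2
        rw [← h1, ← h2, hagree i (by omega)]

lemma length_eq (hσ : Function.Injective σ) (h : IsFoata σ g P t c) (h' : IsFoata σ g P t' c') :
    t = t' := by
  wlog hle : t < t' generalizing t t' c c'
  · rcases Nat.lt_trichotomy t t' with h1 | h1 | h1
    · exact absurd h1 hle
    · exact h1
    · exact (this h' h h1).symm
  exfalso
  obtain ⟨i, hi, h1⟩ := (h.mem (c' t')).1 ((h'.mem _).2 ⟨t', le_rfl, rfl⟩)
  rw [eq_of_le hσ h h' i hi (by omega)] at h1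
  have := h'.inj _ (by omega) _ le_rfl h1
  omega

end IsFoata

/-- The enumeration of a finite type by the natural numbers that is attached to an ordering. -/
def orderingSeq {C : Type*} {t : ℕ} (e : Fin (t + 1) ≃ C) (i : ℕ) : C :=
  e ⟨min i t, by omega⟩

lemma orderingSeq_inj {C : Type*} {t : ℕ} (e : Fin (t + 1) ≃ C) {i j : ℕ} (hi : i ≤ t)
    (hj : j ≤ t) (h : orderingSeq e i = orderingSeq e j) : i = j := by
  have := e.injective h
  simp only [Fin.mk.injEq] at this
  omega

/-- The permutation whose cycles are cut out by the lower records of an ordering. -/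
noncomputable def orderingPerm {C : Type*} [Finite C] {t : ℕ} (σ : C → β) (e : Fin (t + 1) ≃ C) :
    Equiv.Perm C :=
  Equiv.ofBijective
    (fun x => orderingSeq e (recordCycle (fun i => σ (orderingSeq e i)) t (e.symm x)))
    (Finite.injective_iff_bijective.1 fun x y h => by
      have hx := Nat.lt_succ_iff.1 (e.symm x).2
      have hy := Nat.lt_succ_iff.1 (e.symm y).2
      have h1 := orderingSeq_inj e (recordCycle_le _ hx) (recordCycle_le _ hy) h
      exact e.symm.injective (Fin.ext (recordCycle_injOn _ hx hy h1)))

lemma isFoata_orderingPerm {C : Type*} [Finite C] {t : ℕ} (σ : C → β) (e : Fin (t + 1) ≃ C) :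
    IsFoata σ (orderingPerm σ e) Set.univ t (orderingSeq e) where
  inj _ hi _ hj h := orderingSeq_inj e hi hj h
  mem x := by
    have hx := Nat.lt_succ_iff.1 (e.symm x).2
    simp only [Set.mem_univ, true_iff]
    refine ⟨e.symm x, hx, ?_⟩
    simp [orderingSeq, min_eq_left hx]
  map i hi := by
    simp [orderingPerm]
    congr 1
    simp [orderingSeq, min_eq_left hi]

/-- Surjectivity by counting: the orderings of `C` are as many as its permutations, and the
uniqueness of the enumeration makes `orderingPerm σ` injective. -/
lemma exists_isFoata_perm {C : Type*} [Finite C] [Nonempty C] {σ : C → β}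
    (hσ : Function.Injective σ) (g : Equiv.Perm C) : ∃ t c, IsFoata σ g Set.univ t c := by
  classical
  have := Fintype.ofFinite C
  obtain ⟨t, ht⟩ : ∃ t, Fintype.card C = t + 1 := Nat.exists_eq_succ_of_ne_zero Fintype.card_ne_zero
  have hinj : Function.Injective (orderingPerm σ : (Fin (t + 1) ≃ C) → Equiv.Perm C) := by
    intro e e' h
    have h1 := isFoata_orderingPerm σ e
    have h2 := isFoata_orderingPerm σ e'
    rw [← h] at h2
    ext i
    have hi := Nat.lt_succ_iff.1 i.2
    have := IsFoata.eq_of_le hσ h1 h2 i hi hi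
    simpa [orderingSeq, min_eq_left hi] using this
  have e0 : Fin (t + 1) ≃ C := (Fintype.equivFinOfCardEq ht).symm
  have hcard : Fintype.card (Fin (t + 1) ≃ C) = Fintype.card (Equiv.Perm C) := by
    rw [Fintype.card_equiv e0, Fintype.card_perm, ht, Fintype.card_fin]
  obtain ⟨e, he⟩ := ((Fintype.bijective_iff_injective_and_card _).2 ⟨hinj, hcard⟩).2 g
  exact ⟨t, orderingSeq e, he ▸ isFoata_orderingPerm σ e⟩

lemma exists_isFoata [Finite α] {σ : α → β} (hσ : Function.Injective σ) {g : α → α} {P : Set α}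
    (hP : P.Nonempty) (hg : Set.BijOn g P P) : ∃ t c, IsFoata σ g P t c := by
  have : Nonempty P := hP.to_subtype
  obtain ⟨t, c, h⟩ := exists_isFoata_perm (C := P) (σ := fun x => σ x)
    (hσ.comp Subtype.val_injective) (Set.BijOn.equiv g hg)
  refine ⟨t, fun i => c i, ⟨fun i hi j hj hij => h.inj i hi j hj (Subtype.ext hij), fun x => ?_,
    fun i hi => ?_⟩⟩
  · constructor
    · intro hx
      obtain ⟨i, hi, h1⟩ := (h.mem ⟨x, hx⟩).1 trivial
      exact ⟨i, hi, by rw [h1]⟩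
    · rintro ⟨i, -, rfl⟩
      exact (c i).2
  · exact congrArg Subtype.val (h.map i hi)

end Foata

/-! ### Rewiring the transitions that end in a given set of vertices -/

/-- Starting from a vertex of `S`, one returns to `S` only with congruence `0`. -/
def ReturnsAtZero {n k : ℕ} (A : Automaton n) (w : Word k) (S : Set (Fin n)) : Prop :=
  ∀ x ∈ S, ∀ y ∈ S, ∀ r s : ZMod k, ∀ j : ℕ, 1 ≤ j → (explode A w)^[j] (x, r) = (y, s) → s = 0

/-- `A₁` and `A₂` differ only at transitions that end in `S` in both automata. -/
def AgreeOutside {n : ℕ} (A₁ A₂ : Automaton n) (S : Set (Fin n)) : Prop :=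
  ∀ l u, A₁ l u ≠ A₂ l u → A₁ l u ∈ S ∧ A₂ l u ∈ S

lemma exists_iterate_mem_periodicPts {α : Type*} [Finite α] (f : α → α) (x : α) :
    ∃ m, f^[m] x ∈ Function.periodicPts f := by
  obtain ⟨i, j, hij, h⟩ := Finite.exists_ne_map_eq_of_infinite fun i : ℕ => f^[i] x
  wlog hlt : i < j generalizing i j
  · exact this j i hij.symm h.symm (by omega)
  refine ⟨i, j - i, by omega, ?_⟩
  change f^[j - i] (f^[i] x) = f^[i] x
  rw [← Function.iterate_add_apply, Nat.sub_add_cancel hlt.le]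
  exact h.symm

/-- A point from which a periodic point was reached is reached back. -/
lemma exists_iterate_of_periodic {α : Type*} {f : α → α} {x y : α}
    (hx : x ∈ Function.periodicPts f) {m : ℕ} (h : f^[m] x = y) : ∃ m', f^[m'] y = x := by
  obtain ⟨p, hp, hper⟩ := hx
  refine ⟨p * m - m, ?_⟩
  have h1 : m ≤ p * m := Nat.le_mul_of_pos_left m hp
  rw [← h, ← Function.iterate_add_apply, Nat.sub_add_cancel h1]
  exact hper.mul_const m

lemma iterate_mem_periodicPts {α : Type*} {f : α → α} {x : α}
    (hx : x ∈ Function.periodicPts f) (m : ℕ) : f^[m] x ∈ Function.periodicPts f := by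
  obtain ⟨p, hp, hper⟩ := hx
  exact ⟨p, hp, hper.apply_iterate m⟩

section Rewiring

variable {n k : ℕ} {A₁ A₂ : Automaton n} {w : Word k} {S : Set (Fin n)}

lemma explode_iterate_snd (A : Automaton n) (w : Word k) (o : Fin n × ZMod k) (j : ℕ) :
    ((explode A w)^[j] o).2 = o.2 + j := by
  obtain ⟨u, r⟩ := o
  rw [explode_iterate]

lemma AgreeOutside.symm (h : AgreeOutside A₁ A₂ S) : AgreeOutside A₂ A₁ S :=
  fun l u hne => (h l u hne.symm).symm

/-- The walks can separate only at a transition on which the automata differ, and such a transition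
ends in `S` for both. -/
lemma AgreeOutside.iterate_eq (h : AgreeOutside A₁ A₂ S) (o : Fin n × ZMod k) (j : ℕ)
    (hj : ∀ i < j, ((explode A₁ w)^[i + 1] o).1 ∉ S) :
    (explode A₂ w)^[j] o = (explode A₁ w)^[j] o := by
  induction j with
  | zero => rfl
  | succ j ih =>
    have h1 := hj j (by omega)
    rw [Function.iterate_succ_apply', ih fun i hi => hj i (by omega), Function.iterate_succ_apply']
    rw [Function.iterate_succ_apply'] at h1
    set o' := (explode A₁ w)^[j] o
    by_contra hne
    have h2 : A₁ (w (o'.2 + 1)) o'.1 ≠ A₂ (w (o'.2 + 1)) o'.1 := fun h2 => hne (by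
      simp [explode, h2])
    exact h1 (h _ _ h2).1

/-- Up to the first visit of `S` the walks coincide; the entering transition is either common or
ends in `S` for both automata. So both are in `S` at that time, possibly at different vertices. -/
lemma AgreeOutside.first_visit (h : AgreeOutside A₁ A₂ S) (o : Fin n × ZMod k) {j : ℕ}
    (hj : 1 ≤ j) (hjS : ((explode A₁ w)^[j] o).1 ∈ S) :
    ∃ i, 1 ≤ i ∧ i ≤ j ∧ ((explode A₁ w)^[i] o).1 ∈ S ∧ ((explode A₂ w)^[i] o).1 ∈ S := by
  classical
  have hex : ∃ i, ((explode A₁ w)^[i + 1] o).1 ∈ S := ⟨j - 1, by rwa [Nat.sub_add_cancel hj]⟩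
  have hspec := Nat.find_spec hex
  refine ⟨Nat.find hex + 1, by omega, ?_, hspec, ?_⟩
  · have := Nat.find_min' hex (m := j - 1) (by rwa [Nat.sub_add_cancel hj])
    omega
  · have h1 := h.iterate_eq (w := w) o (Nat.find hex) fun i hi => Nat.find_min hex hi
    rw [Function.iterate_succ_apply', h1]
    rw [Function.iterate_succ_apply'] at hspec
    set o' := (explode A₁ w)^[Nat.find hex] o
    by_cases h2 : A₁ (w (o'.2 + 1)) o'.1 = A₂ (w (o'.2 + 1)) o'.1
    · have h3 : (explode A₂ w o').1 = (explode A₁ w o').1 := h2.symm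
      rwa [h3]
    · exact (h _ _ h2).2

/-- The congruence depends only on the elapsed time, and the first visit of the `A₂`-walk is
simultaneous with a visit of the `A₁`-walk. Hence it has congruence `0`, and the argument resumes
from there. -/
lemma ReturnsAtZero.of_agreeOutside (hr : ReturnsAtZero A₁ w S) (h : AgreeOutside A₁ A₂ S) :
    ReturnsAtZero A₂ w S := by
  intro x hx y hy r s j hj hxy
  induction j using Nat.strong_induction_on generalizing x r with
  | _ j ih =>
    obtain ⟨i, hi, hij, h2, h1⟩ := h.symm.first_visit (w := w) (x, r) hj (by rw [hxy]; exact hy)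
    have h0 := hr x hx _ h1 r _ i hi rfl
    rw [explode_iterate_snd] at h0
    rcases Nat.lt_or_eq_of_le hij with hlt | rfl
    · refine ih (j - i) (by omega) _ h2 (r + i) (by omega) ?_
      have : (((explode A₂ w)^[i] (x, r)).1, r + (i : ZMod k)) = (explode A₂ w)^[i] (x, r) :=
        Prod.ext rfl (explode_iterate_snd A₂ w (x, r) i).symm
      rw [this, ← Function.iterate_add_apply, Nat.sub_add_cancel hij, hxy]
    · have := explode_iterate_snd A₂ w (x, r) i
      rw [hxy] at this
      exact this.trans h0

/-- Two visits are needed: the first one only brings the walk into `S`, and the next one, now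
starting from `S`, has congruence `0`. -/
lemma ReturnsAtZero.exists_landing (hr : ReturnsAtZero A₁ w S) (h : AgreeOutside A₁ A₂ S)
    (hall : ∀ o, ∃ j, ((explode A₁ w)^[j] o).1 ∈ S) (o : Fin n × ZMod k) :
    ∃ j, ∃ b ∈ S, (explode A₂ w)^[j] o = (b, 0) := by
  have hall' : ∀ o, ∃ j, 1 ≤ j ∧ ((explode A₁ w)^[j] o).1 ∈ S := fun o => by
    obtain ⟨j, hj⟩ := hall (explode A₁ w o)
    exact ⟨j + 1, by omega, hj⟩
  obtain ⟨j, hj, hjS⟩ := hall' o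
  obtain ⟨i, hi, -, -, h2⟩ := h.first_visit o hj hjS
  obtain ⟨j', hj', hjS'⟩ := hall' ((explode A₂ w)^[i] o)
  obtain ⟨i', hi', -, h3, h4⟩ := h.first_visit _ hj' hjS'
  have h5 := hr _ h2 _ h3 _ _ i' hi' rfl
  refine ⟨i' + i, _, h4, ?_⟩
  rw [Function.iterate_add_apply]
  refine Prod.ext rfl ?_
  rw [explode_iterate_snd] at h5 ⊢
  exact h5

end Rewiring

/-- A node of congruence `0` is reached from every node. -/
lemma exists_iterate_congruence_zero {n k : ℕ} [NeZero k] (A : Automaton n) (w : Word k)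
    (o : Fin n × ZMod k) : ∃ j u, (explode A w)^[j] o = (u, 0) := by
  refine ⟨(-o.2).val, ((explode A w)^[(-o.2).val] o).1, Prod.ext rfl ?_⟩
  rw [explode_iterate_snd, ZMod.natCast_zmod_val, add_neg_cancel]

/-- Every node leads to a node of congruence `0` that is periodic. -/
lemma exists_iterate_periodic {n k : ℕ} [NeZero k] (A : Automaton n) (w : Word k)
    (o : Fin n × ZMod k) :
    ∃ j, ∃ u ∈ Function.periodicPts (inducedMap A w), (explode A w)^[j] o = (u, 0) := by
  obtain ⟨j, u, h⟩ := exists_iterate_congruence_zero A w o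
  obtain ⟨m, hm⟩ := exists_iterate_mem_periodicPts (inducedMap A w) u
  exact ⟨k * m + j, _, hm, by rw [Function.iterate_add_apply, h, explode_iterate_mul]⟩

/-! ### Redirecting the ends of the record blocks -/

/-- The index `i ≤ t` is the last one of its record block. -/
def IsBlockEnd {β : Type*} [LinearOrder β] (s : ℕ → β) (t i : ℕ) : Prop :=
  i ≤ t ∧ (i = t ∨ argminUpTo s (i + 1) = i + 1)

/-- `A₂` is obtained from `A₁` by redirecting, for each end `i` of a record block, the last
transition of the `w`-transition of `c i` towards `tgt i`. -/
structure IsRedirection {n k : ℕ} {β : Type*} [LinearOrder β] (w : Word k) (s : ℕ → β) (t : ℕ)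
    (c : ℕ → Fin n) (tgt : ℕ → Fin n) (A₁ A₂ : Automaton n) : Prop where
  at_end : ∀ i, IsBlockEnd s t i → A₂ (w 0) (walk A₁ w (c i) 0 (k - 1)) = tgt i
  off : ∀ l u, (∀ i, IsBlockEnd s t i → ¬ (l = w 0 ∧ u = walk A₁ w (c i) 0 (k - 1))) →
    A₂ l u = A₁ l u

/-- The vertices at lower records, together with the last vertex. -/
def recordVertices {α β : Type*} [LinearOrder β] (s : ℕ → β) (t : ℕ) (c : ℕ → α) : Set α :=
  {x | (∃ i ≤ t, argminUpTo s i = i ∧ c i = x) ∨ x = c t}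

section Redirection

variable {n k : ℕ} {β : Type*} [LinearOrder β] {w : Word k} {s : ℕ → β} {t : ℕ}
  {c tgt : ℕ → Fin n} {A₁ A₂ A₃ : Automaton n}

lemma IsRedirection.unique (h₂ : IsRedirection w s t c tgt A₁ A₂)
    (h₃ : IsRedirection w s t c tgt A₁ A₃) : A₂ = A₃ := by
  funext l u
  by_cases h : ∃ i, IsBlockEnd s t i ∧ l = w 0 ∧ u = walk A₁ w (c i) 0 (k - 1)
  · obtain ⟨i, hi, rfl, rfl⟩ := h
    rw [h₂.at_end i hi, h₃.at_end i hi]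
  · have h' : ∀ i, IsBlockEnd s t i → ¬ (l = w 0 ∧ u = walk A₁ w (c i) 0 (k - 1)) :=
      fun i hi hh => h ⟨i, hi, hh⟩
    rw [h₂.off l u h', h₃.off l u h']

lemma IsRedirection.congr {s' : ℕ → β} {c' tgt' : ℕ → Fin n}
    (h : IsRedirection w s t c tgt A₁ A₂) (hs : ∀ i, IsBlockEnd s' t i ↔ IsBlockEnd s t i)
    (hc : ∀ i ≤ t, c i = c' i) (htgt : ∀ i ≤ t, tgt i = tgt' i) :
    IsRedirection w s' t c' tgt' A₁ A₂ where
  at_end i hi := by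
    have := (hs i).1 hi
    rw [← hc i this.1, ← htgt i this.1]
    exact h.at_end i this
  off l u hlu := h.off l u fun i hi => by
    rw [hc i hi.1]
    exact hlu i ((hs i).2 hi)

/-- Injectivity ensures that no transition receives two different targets. -/
lemma exists_isRedirection (w : Word k) (s : ℕ → β) (t : ℕ) (c tgt : ℕ → Fin n) (A₁ : Automaton n)
    (hinj : ∀ i ≤ t, ∀ j ≤ t,
      walk A₁ w (c i) 0 (k - 1) = walk A₁ w (c j) 0 (k - 1) → i = j) :
    ∃ A₂, IsRedirection w s t c tgt A₁ A₂ := by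
  classical
  refine ⟨fun l u => if h : ∃ i, IsBlockEnd s t i ∧ l = w 0 ∧ u = walk A₁ w (c i) 0 (k - 1)
    then tgt h.choose else A₁ l u, ⟨fun i hi => ?_, fun l u hlu => ?_⟩⟩
  · have h : ∃ j, IsBlockEnd s t j ∧ w 0 = w 0 ∧
        walk A₁ w (c i) 0 (k - 1) = walk A₁ w (c j) 0 (k - 1) := ⟨i, hi, rfl, rfl⟩
    rw [dif_pos h]
    exact congrArg tgt (hinj _ h.choose_spec.1.1 _ hi.1 h.choose_spec.2.2.symm)
  · rw [dif_neg]
    rintro ⟨i, hi, hh⟩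
    exact hlu i hi hh

lemma IsRedirection.agreeOutside {S : Set (Fin n)} (h : IsRedirection w s t c tgt A₁ A₂)
    (h₁ : ∀ i, IsBlockEnd s t i → A₁ (w 0) (walk A₁ w (c i) 0 (k - 1)) ∈ S)
    (h₂ : ∀ i, IsBlockEnd s t i → tgt i ∈ S) : AgreeOutside A₁ A₂ S := by
  intro l u hne
  by_cases hx : ∃ i, IsBlockEnd s t i ∧ l = w 0 ∧ u = walk A₁ w (c i) 0 (k - 1)
  · obtain ⟨i, hi, rfl, rfl⟩ := hx
    rw [h.at_end i hi]
    exact ⟨h₁ i hi, h₂ i hi⟩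
  · exact absurd (h.off l u fun i hi hh => hx ⟨i, hi, hh⟩).symm hne

lemma IsRedirection.symm {tgt' : ℕ → Fin n} (h : IsRedirection w s t c tgt A₁ A₂)
    (hw : ∀ i ≤ t, walk A₂ w (c i) 0 (k - 1) = walk A₁ w (c i) 0 (k - 1))
    (h₁ : ∀ i, IsBlockEnd s t i → A₁ (w 0) (walk A₁ w (c i) 0 (k - 1)) = tgt' i) :
    IsRedirection w s t c tgt' A₂ A₁ where
  at_end i hi := by rw [hw i hi.1, h₁ i hi]
  off l u hlu := (h.off l u fun i hi => by rw [← hw i hi.1]; exact hlu i hi).symm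

lemma isBlockEnd_iff {i : ℕ} (hi : i ≤ t) :
    IsBlockEnd s t i ↔ ¬ (i < t ∧ ¬ s (i + 1) < s (argminUpTo s i)) := by
  rw [IsBlockEnd, succ_record_iff]
  constructor
  · rintro ⟨-, h⟩ ⟨h1, h2⟩
    rcases h with h | h
    · omega
    · exact h2 h
  · intro h
    refine ⟨hi, ?_⟩
    by_cases h1 : i = t
    · exact Or.inl h1
    · right
      by_contra h2
      exact h ⟨by omega, h2⟩

lemma recordCycle_of_isBlockEnd {i : ℕ} (h : IsBlockEnd s t i) :
    recordCycle s t i = argminUpTo s i := by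
  rw [recordCycle, if_neg ((isBlockEnd_iff h.1).1 h)]

lemma recordCycle_of_not_isBlockEnd {i : ℕ} (hi : i ≤ t) (h : ¬ IsBlockEnd s t i) :
    i < t ∧ recordCycle s t i = i + 1 := by
  rw [isBlockEnd_iff hi, not_not] at h
  exact ⟨h.1, by rw [recordCycle, if_pos h]⟩

lemma argmin_mem_recordVertices {i : ℕ} (hi : i ≤ t) :
    c (argminUpTo s i) ∈ recordVertices s t c :=
  Or.inl ⟨_, (argminUpTo_le s i).trans hi, argminUpTo_idem s i, rfl⟩

/-- The truncation `min (i + 1) t` makes the root `c t` its own successor; every other block end is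
followed by a record. -/
lemma next_mem_recordVertices {i : ℕ} (h : IsBlockEnd s t i) :
    c (min (i + 1) t) ∈ recordVertices s t c := by
  obtain ⟨h1, h2⟩ := h
  by_cases h3 : i = t
  · exact Or.inr (by rw [h3, min_eq_right (by omega)])
  · rw [min_eq_left (by omega)]
    exact Or.inl ⟨i + 1, by omega, by tauto, rfl⟩

/-- One `w`-transition, cut before its last letter. -/
lemma inducedMap_eq_last [NeZero k] (A : Automaton n) (w : Word k) (u : Fin n) :
    inducedMap A w u = A (w 0) (walk A w u 0 (k - 1)) := by
  have hk : k - 1 + 1 = k := Nat.sub_add_cancel (NeZero.one_le)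
  have e : walk A w u 0 k = walk A w u 0 (k - 1 + 1) := congrArg (walk A w u 0) hk.symm
  rw [inducedMap, e, walk_succ]
  congr 2
  rw [zero_add]
  have : ((k - 1 : ℕ) : ZMod k) + 1 = ((k - 1 + 1 : ℕ) : ZMod k) := by push_cast; rfl
  rw [this, hk, ZMod.natCast_self]

/-- If the block is entered from `S` at congruence `0`, then the first `k - 1` transitions are
common to both automata. -/
lemma AgreeOutside.walk_eq [NeZero k] {S : Set (Fin n)} (h : AgreeOutside A₁ A₂ S)
    (hr : ReturnsAtZero A₁ w S) {x u : Fin n} (hx : x ∈ S) {m : ℕ}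
    (hm : (explode A₁ w)^[k * m] (x, 0) = (u, 0)) {b : ℕ} (hb : b < k) :
    (explode A₂ w)^[b] (u, 0) = (explode A₁ w)^[b] (u, 0) := by
  refine h.iterate_eq _ _ fun i hi hS => ?_
  rw [← hm, ← Function.iterate_add_apply] at hS
  have h1 := hr x hx _ hS 0 _ (i + 1 + k * m) (by omega) rfl
  rw [explode_iterate_snd] at h1
  push_cast at h1
  simp only [CharP.cast_eq_zero, zero_mul, add_zero, zero_add] at h1
  have h2 : ((i + 1 : ℕ) : ZMod k) = 0 := by push_cast; exact h1
  rw [ZMod.natCast_eq_zero_iff] at h2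
  have := Nat.le_of_dvd (by omega) h2
  omega

end Redirection

/-! ### From branch-good marked trees to permuted branches -/

lemma mem_branchVertices_iff {n k : ℕ} [NeZero k] {A : Automaton n} {w : Word k} {v : Fin n}
    {σ : Equiv.Perm (Fin n)} {t : ℕ} {c : ℕ → Fin n} (ht : tailLength A w v 0 = k * t)
    (hc : ∀ i ≤ t, walk A w v 0 (k * i) = c i) (x : Fin n) :
    x ∈ branchVertices A w v σ ↔ x ∈ recordVertices (fun i => σ (c i)) t c := by
  have h1 : k * t / k = t := Nat.mul_div_cancel_left _ (NeZero.pos k)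
  simp only [branchVertices, lowerRecords, ht, h1, hc t le_rfl, List.mem_append, List.mem_map,
    List.mem_filter, List.mem_range, decide_eq_true_eq, List.mem_singleton, recordVertices,
    Set.mem_ofPred_eq, argminUpTo_eq_self_iff, Nat.lt_succ_iff]
  refine or_congr (exists_congr fun i => ?_) Iff.rfl
  constructor
  · rintro ⟨⟨h2, h3⟩, h4⟩
    refine ⟨h2, fun j hj => ?_, by rw [← hc i h2, h4]⟩
    rw [← hc i h2, ← hc j (by omega)]
    exact h3 j hj
  · rintro ⟨h2, h3, h4⟩
    refine ⟨⟨h2, fun j hj => ?_⟩, by rw [hc i h2, h4]⟩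
    rw [hc i h2, hc j (by omega)]
    exact h3 j hj

/-- The shape of the branch of a branch-good `0`-shifted marked `w`-tree. -/
lemma goodMarkedTrees.branch {n k : ℕ} [NeZero k] {w : Word k} {A : Automaton n} {v : Fin n}
    {σ : Equiv.Perm (Fin n)} (h : (A, v, σ) ∈ goodMarkedTrees n w) :
    ∃ t, (∀ i < k * (t + 1), ∀ j < k * (t + 1),
        (explode A w)^[i] (v, 0) = (explode A w)^[j] (v, 0) → i = j) ∧
      walk A w v 0 (k * (t + 1)) = walk A w v 0 (k * t) ∧
      (∀ o, ∃ j, (explode A w)^[j] o = (walk A w v 0 (k * t), 0)) ∧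
      ReturnsAtZero A w
        (recordVertices (fun i => σ (walk A w v 0 (k * i))) t fun i => walk A w v 0 (k * i)) := by
  obtain ⟨hgood, htree, -, hshift⟩ := h
  simp only at hgood htree hshift
  obtain ⟨z, hz, huniq⟩ := htree
  obtain ⟨hlt, heq⟩ := tailLength_spec A w v 0
  set T := threadLength A w v 0 with hT
  rw [ZMod.natCast_eq_zero_iff] at hshift
  have hmod : k ∣ tailLength A w v 0 := by
    have := ((explode_iterate_eq_iff A w v 0 _ _).1 heq).2
    exact (Nat.ModEq.dvd_iff this dvd_rfl).2 hshift
  obtain ⟨t, ht⟩ := hmod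
  -- The image of a periodic point is periodic, so the unique cycle of `A_w` is a loop.
  have hfix : inducedMap A w z = z := huniq _ (iterate_mem_periodicPts hz 1)
  have hroot : walk A w v 0 (k * t) = z := by
    refine huniq _ ((periodic_explode_iff A w _).1 ?_)
    refine ⟨T - k * t, by omega, ?_⟩
    have e : (walk A w v 0 (k * t), (0 : ZMod k)) = (explode A w)^[k * t] (v, 0) := by
      rw [explode_iterate]; simp
    rw [e]
    change (explode A w)^[T - k * t] ((explode A w)^[k * t] (v, 0)) = _
    rw [← Function.iterate_add_apply, Nat.sub_add_cancel (by omega), ← heq, ht]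
  have hnext : walk A w v 0 (k * (t + 1)) = walk A w v 0 (k * t) := by
    rw [hroot, walk_mul, Function.iterate_succ_apply', ← walk_mul, hroot, hfix]
  have hTk : T = k * (t + 1) := by
    apply le_antisymm
    · rw [hT, threadLength_eq]
      have hk := NeZero.pos k
      refine Nat.sInf_le ⟨by nlinarith, k * t, by nlinarith, ?_⟩
      rw [explode_iterate_eq_iff]
      refine ⟨hnext.symm, ?_⟩
      rw [mul_add, mul_one]
      exact (Nat.add_modEq_right (a := k * t) (n := k)).symm
    · obtain ⟨m, hm⟩ := hshift
      rw [hm]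
      apply Nat.mul_le_mul_left
      by_contra hlt'
      have : k * m ≤ k * t := Nat.mul_le_mul_left k (by omega)
      omega
  have hreach : ∀ o, ∃ j, (explode A w)^[j] o = (walk A w v 0 (k * t), 0) := by
    intro o
    obtain ⟨j, u, hu, h1⟩ := exists_iterate_periodic A w o
    rw [hroot]
    exact ⟨j, by rw [h1, huniq u hu]⟩
  refine ⟨t, fun i hi j hj hij => iterate_injOn_threadLength A w v 0 (by omega) (by omega) hij,
    hnext, hreach, ?_⟩
  intro x hx y hy r s j hj hxy
  have hmem := mem_branchVertices_iff (σ := σ) ht fun i _ => (rfl : walk A w v 0 (k * i) = _)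
  -- Branch-goodness ignores a return of a node to itself. Such a node is periodic, hence reached
  -- back from the root node, and branch-goodness applies to that pair instead.
  by_cases hne : (y, s) = (x, r)
  · by_contra hs
    obtain ⟨a, ha⟩ := hreach (x, r)
    rw [hne] at hxy
    obtain ⟨a', ha'⟩ := exists_iterate_of_periodic ⟨j, hj, hxy⟩ ha
    have hrs : s = r := (Prod.mk.inj hne).2
    have hroot' : walk A w v 0 (k * t) ∈ branchVertices A w v σ := (hmem _).2 (Or.inr rfl)
    refine hs (hrs.trans (hgood _ hroot' x ((hmem _).2 hx) 0 r ?_ (reaches_of_iterate ha')))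
    intro h0
    exact hs (hrs.trans (Prod.mk.inj h0).2)
  · exact hgood x ((hmem _).2 hx) y ((hmem _).2 hy) r s hne (reaches_of_iterate hxy)

/-- Cutting the branch at its lower records turns a branch-good `0`-shifted marked `w`-tree into an
automaton whose recurrent `w`-transitions are described by the branch. -/
lemma exists_cut {n k : ℕ} [NeZero k] {w : Word k} {A : Automaton n} {v : Fin n}
    {σ : Equiv.Perm (Fin n)} (h : (A, v, σ) ∈ goodMarkedTrees n w) :
    ∃ A' t c, IsFoata σ (inducedMap A' w) (Function.periodicPts (inducedMap A' w)) t c ∧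
      c 0 = v ∧ IsRedirection w (fun i => σ (c i)) t c (fun i => c (min (i + 1) t)) A' A := by
  obtain ⟨t, hinj, hnext, hreach, hret⟩ := goodMarkedTrees.branch h
  set c : ℕ → Fin n := fun i => walk A w v 0 (k * i) with hc
  set s : ℕ → Fin n := fun i => σ (c i) with hs
  have hk : 0 < k := NeZero.pos k
  have hc0 : c 0 = v := by simp [hc, walk]
  have hnode : ∀ i, (explode A w)^[k * i] (v, 0) = (c i, 0) := fun i => by
    rw [explode_iterate]; simp [hc]
  have hcinj : ∀ i ≤ t, ∀ j ≤ t, c i = c j → i = j := by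
    intro i hi j hj hij
    have : k * i = k * j := hinj _ (Nat.mul_lt_mul_of_pos_left (by omega) hk) _
      (Nat.mul_lt_mul_of_pos_left (by omega) hk) (by rw [hnode, hnode, hij])
    exact Nat.eq_of_mul_eq_mul_left hk this
  have hstep : ∀ i, inducedMap A w (c i) = c (i + 1) := fun i => by
    simp only [hc, walk_mul, Function.iterate_succ_apply']
  have hlast : ∀ i ≤ t, A (w 0) (walk A w (c i) 0 (k - 1)) = c (min (i + 1) t) := by
    intro i hi
    rw [← inducedMap_eq_last A w, hstep]
    rcases Nat.lt_or_eq_of_le hi with hlt | rfl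
    · rw [min_eq_left (by omega)]
    · rw [min_eq_right (by omega)]
      exact hnext
  -- The nodes at times `k - 1 + k * i` are distinct and share one congruence, so their vertices are
  -- distinct.
  have hpinj : ∀ i ≤ t, ∀ j ≤ t,
      walk A w (c i) 0 (k - 1) = walk A w (c j) 0 (k - 1) → i = j := by
    intro i hi j hj hij
    have hb : ∀ i ≤ t, k - 1 + k * i < k * (t + 1) := fun i hi => by
      have := Nat.mul_le_mul_left k hi
      rw [mul_add]; omega
    have := hinj _ (hb i hi) _ (hb j hj) (by
      rw [Function.iterate_add_apply, Function.iterate_add_apply, hnode, hnode, explode_iterate,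
        explode_iterate, hij])
    exact Nat.eq_of_mul_eq_mul_left hk (by omega)
  obtain ⟨A', hA'⟩ := exists_isRedirection w s t c (fun i => c (argminUpTo s i)) A hpinj
  have hagree : AgreeOutside A A' (recordVertices s t c) :=
    hA'.agreeOutside (fun i hi => by rw [hlast i hi.1]; exact next_mem_recordVertices hi)
      fun i hi => argmin_mem_recordVertices hi.1
  have hv : v ∈ recordVertices s t c := Or.inl ⟨0, by omega, rfl, hc0⟩
  have hwalk : ∀ i ≤ t, walk A' w (c i) 0 (k - 1) = walk A w (c i) 0 (k - 1) := fun i hi => by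
    rw [walk_eq_iterate, walk_eq_iterate, hagree.walk_eq hret hv (hnode i) (by omega)]
  have hmap : ∀ i ≤ t, inducedMap A' w (c i) = c (recordCycle s t i) := by
    intro i hi
    rw [inducedMap_eq_last, hwalk i hi]
    by_cases he : IsBlockEnd s t i
    · rw [hA'.at_end i he, recordCycle_of_isBlockEnd he]
    · obtain ⟨h1, h2⟩ := recordCycle_of_not_isBlockEnd hi he
      rw [h2, hA'.off, hlast i hi, min_eq_left (by omega)]
      rintro j hj ⟨-, hij⟩
      exact he (hpinj i hi j hj.1 hij ▸ hj)
  have hclosed : ∀ i ≤ t, ∀ m, ∃ j ≤ t, (inducedMap A' w)^[m] (c i) = c j := by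
    intro i hi m
    induction m with
    | zero => exact ⟨i, hi, rfl⟩
    | succ m ih =>
      obtain ⟨j, hj, h1⟩ := ih
      exact ⟨_, recordCycle_le s hj, by rw [Function.iterate_succ_apply', h1, hmap j hj]⟩
  have hcancel : ∀ m, ∀ i ≤ t, ∀ j ≤ t,
      (inducedMap A' w)^[m] (c i) = (inducedMap A' w)^[m] (c j) → i = j := by
    intro m
    induction m with
    | zero => exact hcinj
    | succ m ih =>
      intro i hi j hj hij
      rw [Function.iterate_succ_apply, Function.iterate_succ_apply, hmap i hi, hmap j hj] at hij
      exact recordCycle_injOn s hi hj (ih _ (recordCycle_le s hi) _ (recordCycle_le s hj) hij)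
  refine ⟨A', t, c, ⟨hcinj, fun x => ⟨fun hx => ?_, ?_⟩, hmap⟩, hc0, hA'.symm hwalk
    fun i hi => hlast i hi.1⟩
  -- A periodic point of the new map leads to some `c i` at congruence `0`, is reached back from it,
  -- and the `c i` are stable under the map.
  · obtain ⟨j, b, hb, hj⟩ := hret.exists_landing hagree (fun o => by
      obtain ⟨j, hj⟩ := hreach o
      exact ⟨j, by rw [hj]; exact Or.inr rfl⟩) (x, 0)
    obtain ⟨i, hi, rfl⟩ : ∃ i ≤ t, c i = b := by
      rcases hb with ⟨i, hi, -, h1⟩ | h1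
      · exact ⟨i, hi, h1⟩
      · exact ⟨t, le_rfl, h1.symm⟩
    obtain ⟨m, rfl⟩ : k ∣ j := by
      have := explode_iterate_snd A' w (x, 0) j
      rw [hj] at this
      simp only [zero_add] at this
      exact (ZMod.natCast_eq_zero_iff j k).1 this.symm
    rw [explode_iterate_mul] at hj
    obtain ⟨m', hm'⟩ := exists_iterate_of_periodic hx (Prod.mk.inj hj).1
    obtain ⟨j, hj, h1⟩ := hclosed i hi m'
    exact ⟨j, hj, by rw [← h1, hm']⟩
  -- Some iterate of `c i` is periodic; iterates are injective on the branch, so its period is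
  -- already one of `c i`.
  · rintro ⟨i, hi, rfl⟩
    obtain ⟨m, p, hp, hper⟩ := exists_iterate_mem_periodicPts (inducedMap A' w) (c i)
    refine ⟨p, hp, ?_⟩
    have h1 : (inducedMap A' w)^[p] ((inducedMap A' w)^[m] (c i)) = (inducedMap A' w)^[m] (c i) :=
      hper
    obtain ⟨j, hj, h2⟩ := hclosed i hi p
    rw [← Function.iterate_add_apply, add_comm, Function.iterate_add_apply, h2] at h1
    have := hcancel m _ hj _ hi h1
    change (inducedMap A' w)^[p] (c i) = c i
    rw [h2, this]

/-- From `(A', σ)` the enumeration `c` is recovered by Foata uniqueness; then `v = c 0`, and `A` is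
the unique redirection of `A'` along `c`. -/
lemma ncard_goodMarkedTrees_le {n k : ℕ} [NeZero k] (w : Word k) :
    (goodMarkedTrees n w).ncard ≤ Nat.card (Automaton n × Equiv.Perm (Fin n)) := by
  classical
  have hex : ∀ x : MarkedLabelledAutomaton n, ∃ A', x ∈ goodMarkedTrees n w → ∃ t c,
      IsFoata x.2.2 (inducedMap A' w) (Function.periodicPts (inducedMap A' w)) t c ∧
      c 0 = x.2.1 ∧
      IsRedirection w (fun i => x.2.2 (c i)) t c (fun i => c (min (i + 1) t)) A' x.1 := by
    intro x
    by_cases hx : x ∈ goodMarkedTrees n w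
    · obtain ⟨A', h⟩ := exists_cut (A := x.1) (v := x.2.1) (σ := x.2.2) hx
      exact ⟨A', fun _ => h⟩
    · exact ⟨x.1, fun h => absurd h hx⟩
  choose f hf using hex
  rw [← Set.ncard_univ]
  refine Set.ncard_le_ncard_of_injOn (fun x => (f x, x.2.2)) (fun _ _ => Set.mem_univ _) ?_
    (Set.toFinite _)
  rintro ⟨A₁, v₁, σ₁⟩ hx₁ ⟨A₂, v₂, σ₂⟩ hx₂ heq
  obtain ⟨t₁, c₁, hF₁, hv₁, hR₁⟩ := hf _ hx₁
  obtain ⟨t₂, c₂, hF₂, hv₂, hR₂⟩ := hf _ hx₂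
  obtain ⟨hf12, hσ⟩ := Prod.mk.inj heq
  simp only at hσ hF₁ hF₂ hv₁ hv₂ hR₁ hR₂
  subst hσ
  rw [← hf12] at hF₂ hR₂
  obtain rfl := hF₁.length_eq σ₁.injective hF₂
  have hcc := fun i hi => hF₁.eq_of_le σ₁.injective hF₂ i hi hi
  have hv : v₁ = v₂ := by rw [← hv₁, ← hv₂, hcc 0 (by omega)]
  have hA : A₁ = A₂ := by
    refine (hR₁.congr (fun i => ?_) hcc fun i _ => hcc _ (by omega)).unique hR₂
    have hrec : ∀ i ≤ t₁, (argminUpTo (fun i => σ₁ (c₂ i)) i = i ↔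
        argminUpTo (fun i => σ₁ (c₁ i)) i = i) := fun i hi =>
      ⟨hF₂.record_of_record hF₁ hi hi fun j hj => (hcc j (by omega)).symm,
        hF₁.record_of_record hF₂ hi hi fun j hj => hcc j (by omega)⟩
    simp only [IsBlockEnd]
    refine and_congr_right fun hi => ?_
    by_cases hit : i = t₁
    · simp [hit]
    · rw [hrec (i + 1) (by omega)]
  rw [hA, hv]

/-! ### From automata with good cycles to branch-good marked trees -/

/-- `m` carries the smallest label of its cycle in `A_w`. -/
def IsCycleMin {n k : ℕ} (A : Automaton n) (w : Word k) (σ : Equiv.Perm (Fin n)) (m : Fin n) :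
    Prop :=
  m ∈ Function.periodicPts (inducedMap A w) ∧ ∀ i, σ m ≤ σ ((inducedMap A w)^[i] m)

/-- The vertices with the smallest label of a cycle of `A_w`, and their predecessors. -/
def specialVertices {n k : ℕ} (A : Automaton n) (w : Word k) (σ : Equiv.Perm (Fin n)) :
    Set (Fin n) :=
  {y | y ∈ Function.periodicPts (inducedMap A w) ∧
    (IsCycleMin A w σ y ∨ IsCycleMin A w σ (inducedMap A w y))}

/-- The labelled automata for which special vertices return to each other only at congruence `0`. -/
def cycleGood (n : ℕ) {k : ℕ} (w : Word k) : Set (Automaton n × Equiv.Perm (Fin n)) :=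
  {x | ReturnsAtZero x.1 w (specialVertices x.1 w x.2)}

/-- Concatenating the cycles turns an automaton with good cycles into a branch-good `0`-shifted
marked `w`-tree. -/
lemma exists_glue {n k : ℕ} [NeZero k] [NeZero n] {w : Word k} {A' : Automaton n}
    {σ : Equiv.Perm (Fin n)} (h : (A', σ) ∈ cycleGood n w) :
    ∃ A t c, (A, c 0, σ) ∈ goodMarkedTrees n w ∧ tailLength A w (c 0) 0 = k * t ∧
      (∀ i ≤ t, walk A w (c 0) 0 (k * i) = c i) ∧
      IsRedirection w (fun i => σ (c i)) t c
        (fun i => c (argminUpTo (fun i => σ (c i)) i)) A A' := by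
  have hk : 0 < k := NeZero.pos k
  set g' := inducedMap A' w with hg'
  have hne : (Function.periodicPts g').Nonempty := by
    obtain ⟨m, hm⟩ := exists_iterate_mem_periodicPts g' (0 : Fin n)
    exact ⟨_, hm⟩
  obtain ⟨t, c, hF⟩ := exists_isFoata σ.injective hne (Function.bijOn_periodicPts g')
  set s : ℕ → Fin n := fun i => σ (c i) with hs
  have hper : ∀ i ≤ t, c i ∈ Function.periodicPts g' := fun i hi => (hF.mem _).2 ⟨i, hi, rfl⟩
  have hmin : ∀ i ≤ t, argminUpTo s i = i → IsCycleMin A' w σ (c i) := fun i hi hr =>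
    ⟨hper i hi, fun m => hF.le_of_iterate hi m hr⟩
  have hend : IsBlockEnd s t t := ⟨le_rfl, Or.inl rfl⟩
  have hret : ReturnsAtZero A' w (recordVertices s t c) := by
    -- The records are cycle minima. The last vertex is a block end, so its image is a cycle
    -- minimum; this is why predecessors count as special.
    have hsub : recordVertices s t c ⊆ specialVertices A' w σ := by
      rintro x (⟨i, hi, hr, rfl⟩ | rfl)
      · exact ⟨hper i hi, Or.inl (hmin i hi hr)⟩
      · refine ⟨hper t le_rfl, Or.inr ?_⟩
        rw [← hg', hF.map t le_rfl, recordCycle_of_isBlockEnd hend]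
        exact hmin _ (argminUpTo_le s t) (argminUpTo_idem s t)
    exact fun x hx y hy => h x (hsub hx) y (hsub hy)
  have hlast' : ∀ i ≤ t, A' (w 0) (walk A' w (c i) 0 (k - 1)) = c (recordCycle s t i) := by
    intro i hi
    rw [← inducedMap_eq_last A' w, ← hg', hF.map i hi]
  have hpinj : ∀ i ≤ t, ∀ j ≤ t,
      walk A' w (c i) 0 (k - 1) = walk A' w (c j) 0 (k - 1) → i = j := by
    intro i hi j hj hij
    refine recordCycle_injOn s hi hj (hF.inj _ (recordCycle_le s hi) _ (recordCycle_le s hj) ?_)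
    rw [← hlast' i hi, ← hlast' j hj, hij]
  obtain ⟨A, hA⟩ := exists_isRedirection w s t c (fun i => c (min (i + 1) t)) A' hpinj
  have hagree : AgreeOutside A' A (recordVertices s t c) :=
    hA.agreeOutside (fun i hi => by
      rw [hlast' i hi.1, recordCycle_of_isBlockEnd hi]
      exact argmin_mem_recordVertices hi.1) fun i hi => next_mem_recordVertices hi
  -- In `A'`, the vertex `c i` is reached from the record of its block by whole `w`-transitions, so
  -- no intermediate letter meets a redirected transition.
  have hshort : ∀ i ≤ t, ∀ b < k,
      (explode A w)^[b] (c i, 0) = (explode A' w)^[b] (c i, 0) := by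
    intro i hi b hb
    obtain ⟨m, hm⟩ := hF.iterate_argmin hi
    exact hagree.walk_eq hret (argmin_mem_recordVertices hi) (m := m)
      (by rw [explode_iterate_mul, hm]) hb
  have hwalk : ∀ i ≤ t, walk A w (c i) 0 (k - 1) = walk A' w (c i) 0 (k - 1) := fun i hi => by
    rw [walk_eq_iterate, walk_eq_iterate, hshort i hi _ (by omega)]
  have hstep : ∀ i ≤ t, inducedMap A w (c i) = c (min (i + 1) t) := by
    intro i hi
    rw [inducedMap_eq_last, hwalk i hi]
    by_cases he : IsBlockEnd s t i
    · rw [hA.at_end i he]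
    · obtain ⟨h1, h2⟩ := recordCycle_of_not_isBlockEnd hi he
      rw [hA.off, hlast' i hi, h2, min_eq_left (by omega)]
      rintro j hj ⟨-, hij⟩
      exact he (hpinj i hi j hj.1 hij ▸ hj)
  have hiter : ∀ i ≤ t, ∀ m, (inducedMap A w)^[m] (c i) = c (min (i + m) t) := by
    intro i hi m
    induction m with
    | zero => simp [min_eq_left hi]
    | succ m ih =>
      rw [Function.iterate_succ_apply', ih, hstep _ (by omega)]
      congr 1
      omega
  have hbranch : ∀ i ≤ t, walk A w (c 0) 0 (k * i) = c i := fun i hi => by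
    rw [walk_mul, hiter 0 (by omega), zero_add, min_eq_left hi]
  have hnode : ∀ a ≤ t, ∀ b < k,
      (explode A w)^[b + k * a] (c 0, 0) = (explode A' w)^[b] (c a, 0) := by
    intro a ha b hb
    rw [Function.iterate_add_apply, explode_iterate_mul, hiter 0 (by omega), zero_add,
      min_eq_left ha, hshort a ha b hb]
  -- Two equal nodes have equal times modulo `k`; completing their `w`-transitions in `A'` leads to
  -- the Foata map, which is injective on the `c i`.
  have hnodes_inj : ∀ i < k * (t + 1), ∀ j < k * (t + 1),
      (explode A w)^[i] (c 0, 0) = (explode A w)^[j] (c 0, 0) → i = j := by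
    intro i hi j hj hij
    have hmod : i % k = j % k := ((explode_iterate_eq_iff A w _ _ _ _).1 hij).2
    have hdi : i / k ≤ t := Nat.lt_succ_iff.1 (Nat.div_lt_of_lt_mul hi)
    have hdj : j / k ≤ t := Nat.lt_succ_iff.1 (Nat.div_lt_of_lt_mul hj)
    have hb := Nat.mod_lt j hk
    rw [← Nat.mod_add_div i k, ← Nat.mod_add_div j k, hmod, hnode _ hdi _ hb,
      hnode _ hdj _ hb] at hij
    have h1 := congrArg (explode A' w)^[k - j % k] hij
    rw [← Function.iterate_add_apply, ← Function.iterate_add_apply, Nat.sub_add_cancel hb.le] at h1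
    have h2 : inducedMap A' w (c (i / k)) = inducedMap A' w (c (j / k)) := by
      rw [inducedMap, inducedMap, walk_eq_iterate, walk_eq_iterate, h1]
    rw [← hg', hF.map _ hdi, hF.map _ hdj] at h2
    have h3 := recordCycle_injOn s hdi hdj
      (hF.inj _ (recordCycle_le s hdi) _ (recordCycle_le s hdj) h2)
    rw [← Nat.mod_add_div i k, ← Nat.mod_add_div j k, hmod, h3]
  obtain ⟨hT, htail⟩ := threadLength_unique A w (c 0) 0 (t := k * t) (T := k * (t + 1))
    (by rw [mul_add]; omega) (by
      rw [explode_iterate_mul, explode_iterate_mul, hiter 0 (by omega), hiter 0 (by omega)]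
      congr 2
      omega) hnodes_inj
  have hretA : ReturnsAtZero A w (recordVertices s t c) := hret.of_agreeOutside hagree
  have hland : ∀ o, ∃ j, (explode A w)^[j] o = (c t, 0) := by
    intro o
    obtain ⟨j, b, hb, hj⟩ := hret.exists_landing hagree (fun o => by
      obtain ⟨j, u, hu, h1⟩ := exists_iterate_periodic A' w o
      obtain ⟨i, hi, rfl⟩ := (hF.mem u).1 hu
      obtain ⟨m, hm⟩ := hF.iterate_argmin hi
      obtain ⟨m', hm'⟩ := exists_iterate_of_periodic
        (hper _ ((argminUpTo_le s i).trans hi)) hm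
      refine ⟨k * m' + j, ?_⟩
      rw [Function.iterate_add_apply, h1, explode_iterate_mul, ← hg', hm']
      exact argmin_mem_recordVertices hi) o
    obtain ⟨i, hi, rfl⟩ : ∃ i ≤ t, c i = b := by
      rcases hb with ⟨i, hi, -, h1⟩ | h1
      · exact ⟨i, hi, h1⟩
      · exact ⟨t, le_rfl, h1.symm⟩
    refine ⟨k * t + j, ?_⟩
    rw [Function.iterate_add_apply, hj, explode_iterate_mul, hiter i hi]
    congr 2
    omega
  have hroot : inducedMap A w (c t) = c t := by
    rw [hstep t le_rfl, min_eq_right (by omega)]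
  have htree : IsWTree A w := by
    refine ⟨c t, ⟨1, one_pos, hroot⟩, fun x hx => ?_⟩
    obtain ⟨j, hj⟩ := hland (x, 0)
    obtain ⟨m, rfl⟩ : k ∣ j := by
      have := explode_iterate_snd A w (x, 0) j
      rw [hj] at this
      simp only [zero_add] at this
      exact (ZMod.natCast_eq_zero_iff j k).1 this.symm
    rw [explode_iterate_mul] at hj
    obtain ⟨m', hm'⟩ := exists_iterate_of_periodic hx (Prod.mk.inj hj).1
    rw [← hm', hiter t le_rfl, min_eq_right (by omega)]
  refine ⟨A, t, c, ⟨?_, htree, htree, ?_⟩, htail, hbranch, ?_⟩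
  · intro x hx y hy r s' hne' hreach
    rw [mem_branchVertices_iff htail hbranch] at hx hy
    obtain ⟨j, -, hj⟩ := reaches_iff.1 hreach
    refine hretA x hx y hy r s' j ?_ hj
    rcases Nat.eq_zero_or_pos j with rfl | hpos
    · exact absurd hj.symm hne'
    · exact hpos
  · simp only
    rw [hT]
    simp
  · exact hA.symm hwalk fun i hi => by rw [hlast' i hi.1, recordCycle_of_isBlockEnd hi]

/-- The tree and its mark determine `t` (the tail length is `k * t`) and the path `c`; undoing the
redirection then recovers `A'`. -/
lemma ncard_cycleGood_le {n k : ℕ} [NeZero k] [NeZero n] (w : Word k) :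
    (cycleGood n w).ncard ≤ (goodMarkedTrees n w).ncard := by
  classical
  have hex : ∀ x : Automaton n × Equiv.Perm (Fin n), ∃ y : MarkedLabelledAutomaton n,
      x ∈ cycleGood n w → ∃ t c,
      y ∈ goodMarkedTrees n w ∧ y.2.1 = c 0 ∧ y.2.2 = x.2 ∧
      tailLength y.1 w (c 0) 0 = k * t ∧ (∀ i ≤ t, walk y.1 w (c 0) 0 (k * i) = c i) ∧
      IsRedirection w (fun i => x.2 (c i)) t c
        (fun i => c (argminUpTo (fun i => x.2 (c i)) i)) y.1 x.1 := by
    intro x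
    by_cases hx : x ∈ cycleGood n w
    · obtain ⟨A, t, c, h1, h2, h3, h4⟩ := exists_glue (A' := x.1) (σ := x.2) hx
      exact ⟨(A, c 0, x.2), fun _ => ⟨t, c, h1, rfl, rfl, h2, h3, h4⟩⟩
    · exact ⟨(x.1, 0, x.2), fun h => absurd h hx⟩
  choose f hf using hex
  refine Set.ncard_le_ncard_of_injOn f (fun x hx => ?_) ?_ (Set.toFinite _)
  · obtain ⟨t, c, h, -⟩ := hf x hx
    exact h
  rintro ⟨A₁, σ₁⟩ hx₁ ⟨A₂, σ₂⟩ hx₂ heq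
  obtain ⟨t₁, c₁, -, hv₁, hσ₁, ht₁, hc₁, hR₁⟩ := hf _ hx₁
  obtain ⟨t₂, c₂, -, hv₂, hσ₂, ht₂, hc₂, hR₂⟩ := hf _ hx₂
  rw [← heq] at hv₂ hσ₂ ht₂ hc₂ hR₂
  rw [← hv₁] at ht₁ hc₁
  rw [← hv₂] at ht₂ hc₂
  simp only at hσ₁ hσ₂ hR₁ hR₂
  obtain rfl : σ₁ = σ₂ := hσ₁.symm.trans hσ₂
  obtain rfl : t₁ = t₂ := Nat.eq_of_mul_eq_mul_left (NeZero.pos k) (ht₁.symm.trans ht₂)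
  have hcc : ∀ i ≤ t₁, c₁ i = c₂ i := fun i hi => (hc₁ i hi).symm.trans (hc₂ i hi)
  have harg : ∀ i ≤ t₁, argminUpTo (fun i => σ₁ (c₁ i)) i = argminUpTo (fun i => σ₁ (c₂ i)) i := by
    exact fun i hi => argminUpTo_congr fun j hj => by rw [hcc j (by omega)]
  have hA : A₁ = A₂ := by
    refine (hR₁.congr (fun i => ?_) hcc fun i hi => ?_).unique hR₂
    · simp only [IsBlockEnd]
      refine and_congr_right fun hi => ?_
      by_cases hit : i = t₁
      · simp [hit]
      · rw [harg (i + 1) (by omega)]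
    · have := argminUpTo_le (fun i => σ₁ (c₂ i)) i
      rw [harg i hi, hcc _ (by omega)]
  rw [hA]

/-! ### Adaptive exploration of a random automaton -/

open scoped Classical in
/-- The automaton `A` with the transition `e` redirected to `z`. -/
noncomputable def setEdge {n : ℕ} (A : Automaton n) (e : Letter × Fin n) (z : Fin n) :
    Automaton n :=
  fun l u => if (l, u) = e then z else A l u

/-- The end of the transition `e`. -/
def endpoint {n : ℕ} (A : Automaton n) (e : Letter × Fin n) : Fin n := A e.1 e.2

/-- The next query depends only on the answers to the previous ones. -/
def IsAdaptive {n : ℕ} (edge : Automaton n → ℕ → Letter × Fin n) : Prop :=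
  ∀ A B t, (∀ s < t, endpoint A (edge A s) = endpoint B (edge A s)) → edge B t = edge A t

/-- The query at time `t` was not made before. -/
def IsFresh {n : ℕ} (edge : Automaton n → ℕ → Letter × Fin n) (A : Automaton n) (t : ℕ) : Prop :=
  ∀ s < t, edge A s ≠ edge A t

section Exploration

variable {n : ℕ} {edge : Automaton n → ℕ → Letter × Fin n}

@[simp] lemma endpoint_setEdge_self (A : Automaton n) (e : Letter × Fin n) (z : Fin n) :
    endpoint (setEdge A e z) e = z := by
  simp [endpoint, setEdge]

lemma endpoint_setEdge_of_ne (A : Automaton n) {e e' : Letter × Fin n} (h : e' ≠ e) (z : Fin n) :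
    endpoint (setEdge A e z) e' = endpoint A e' := by
  simp [endpoint, setEdge, h]

lemma setEdge_setEdge (A : Automaton n) (e : Letter × Fin n) (z : Fin n) :
    setEdge (setEdge A e z) e (endpoint A e) = A := by
  funext l u
  by_cases h : (l, u) = e
  · simp [setEdge, endpoint, ← h]
  · simp [setEdge, h]

/-- Exchanging the answer to the query with `z` is an involution of `Q × [n]`, because the query
itself is unaffected by its answer. -/
lemma sum_resample (Q : Finset (Automaton n)) (e : Automaton n → Letter × Fin n)
    (hQ : ∀ A ∈ Q, ∀ z, setEdge A (e A) z ∈ Q ∧ e (setEdge A (e A) z) = e A)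
    (G : Automaton n → ℝ) :
    ∑ A ∈ Q, ∑ z, G (setEdge A (e A) z) = n * ∑ A ∈ Q, G A := by
  have h1 : (n : ℝ) * ∑ A ∈ Q, G A = ∑ x ∈ Q ×ˢ (Finset.univ : Finset (Fin n)), G x.1 := by
    rw [Finset.sum_product]
    simp [Finset.mul_sum]
  rw [h1, ← Finset.sum_product']
  have key : ∀ x ∈ Q ×ˢ (Finset.univ : Finset (Fin n)),
      (setEdge x.1 (e x.1) x.2, endpoint x.1 (e x.1)) ∈ Q ×ˢ (Finset.univ : Finset (Fin n)) :=
    fun x hx => by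
      simp only [Finset.mem_product, Finset.mem_univ, and_true] at hx ⊢
      exact (hQ x.1 hx x.2).1
  refine Finset.sum_nbij' (fun x => (setEdge x.1 (e x.1) x.2, endpoint x.1 (e x.1)))
    (fun x => (setEdge x.1 (e x.1) x.2, endpoint x.1 (e x.1))) key key ?_ ?_ fun _ _ => rfl
  all_goals
    rintro ⟨A, z⟩ hx
    simp only [Finset.mem_product, Finset.mem_univ, and_true] at hx
    simp only [(hQ A hx z).2, setEdge_setEdge, endpoint_setEdge_self]

lemma IsAdaptive.edge_setEdge (h : IsAdaptive edge) {A : Automaton n} {t : ℕ}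
    (hf : IsFresh edge A t) (z : Fin n) {s : ℕ} (hs : s ≤ t) :
    edge (setEdge A (edge A t) z) s = edge A s :=
  h _ _ _ fun s' hs' => (endpoint_setEdge_of_ne A (hf s' (by omega)) z).symm

lemma IsAdaptive.isFresh_setEdge_iff (h : IsAdaptive edge) {A : Automaton n} {t : ℕ}
    (hf : IsFresh edge A t) (z : Fin n) {s : ℕ} (hs : s ≤ t) :
    IsFresh edge (setEdge A (edge A t) z) s ↔ IsFresh edge A s := by
  refine forall₂_congr fun s' hs' => ?_
  rw [h.edge_setEdge hf z hs, h.edge_setEdge hf z (by omega)]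

open scoped Classical in
/-- Each fresh query with a prescribed answer costs a factor `n`. -/
lemma card_fresh_hits_le (h : IsAdaptive edge) (tgt : ℕ → Automaton n → Fin n) (S : Finset ℕ)
    (htgt : ∀ τ ∈ S, ∀ A B, (∀ s < τ, endpoint A (edge A s) = endpoint B (edge A s)) →
      tgt τ B = tgt τ A) :
    ((Finset.univ.filter fun A : Automaton n => ∀ τ ∈ S, IsFresh edge A τ ∧
      endpoint A (edge A τ) = tgt τ A).card : ℝ) * (n : ℝ) ^ S.card ≤
      Fintype.card (Automaton n) := by
  -- The latest prescribed query is peeled off: resampling its answer leaves all earlier queries and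
  -- answers intact.
  induction S using Finset.induction_on_max with
  | empty => simp
  | insert a S ha ih =>
    have ih' := ih fun τ hτ => htgt τ (Finset.mem_insert_of_mem hτ)
    have hnotin : a ∉ S := fun h => lt_irrefl _ (ha a h)
    set Q : Finset (Automaton n) := Finset.univ.filter fun A => (∀ τ ∈ S, IsFresh edge A τ ∧
      endpoint A (edge A τ) = tgt τ A) ∧ IsFresh edge A a with hQdef
    have hagree : ∀ A, IsFresh edge A a → ∀ z, ∀ s < a,
        endpoint A (edge A s) = endpoint (setEdge A (edge A a) z) (edge A s) :=
      fun A hA z s hs => (endpoint_setEdge_of_ne A (hA s hs) z).symm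
    have hQ : ∀ A ∈ Q, ∀ z, setEdge A (edge A a) z ∈ Q ∧
        edge (setEdge A (edge A a) z) a = edge A a := by
      intro A hA z
      simp only [hQdef, Finset.mem_filter, Finset.mem_univ, true_and] at hA ⊢
      refine ⟨⟨fun τ hτ => ?_, (h.isFresh_setEdge_iff hA.2 z le_rfl).2 hA.2⟩,
        h.edge_setEdge hA.2 z le_rfl⟩
      have hlt := ha τ hτ
      refine ⟨(h.isFresh_setEdge_iff hA.2 z hlt.le).2 (hA.1 τ hτ).1, ?_⟩
      rw [h.edge_setEdge hA.2 z hlt.le, endpoint_setEdge_of_ne A (hA.2 τ hlt),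
        htgt τ (Finset.mem_insert_of_mem hτ) A _ fun s hs => hagree A hA.2 z s (hs.trans hlt),
        (hA.1 τ hτ).2]
    have hsum := sum_resample Q (fun A => edge A a) hQ
      fun A => if endpoint A (edge A a) = tgt a A then 1 else 0
    -- The target depends on earlier answers only, so exactly one of the `n` answers hits it.
    have hone : ∀ A ∈ Q, (∑ z, if endpoint (setEdge A (edge A a) z)
        (edge (setEdge A (edge A a) z) a) = tgt a (setEdge A (edge A a) z) then (1 : ℝ) else 0)
          = 1 := by
      intro A hA
      have hfa : IsFresh edge A a := by
        simp only [hQdef, Finset.mem_filter] at hA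
        exact hA.2.2
      have : ∀ z, tgt a (setEdge A (edge A a) z) = tgt a A := fun z =>
        htgt a (Finset.mem_insert_self _ _) A _ fun s hs => hagree A hfa z s hs
      simp only [h.edge_setEdge hfa _ le_rfl, this, endpoint_setEdge_self]
      simp
    rw [Finset.sum_congr rfl hone, ← Finset.sum_filter] at hsum
    simp only [Finset.sum_const, nsmul_eq_mul, mul_one] at hsum
    rw [Finset.card_insert_of_notMem hnotin, pow_succ]
    have hle : (Q.card : ℝ) ≤ ((Finset.univ.filter fun A : Automaton n => ∀ τ ∈ S,
        IsFresh edge A τ ∧ endpoint A (edge A τ) = tgt τ A).card : ℝ) := by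
      exact_mod_cast Finset.card_le_card fun A hA => by
        simp only [hQdef, Finset.mem_filter, Finset.mem_univ, true_and] at hA ⊢
        exact hA.1
    have hset : (Finset.univ.filter fun A : Automaton n => ∀ τ ∈ insert a S, IsFresh edge A τ ∧
        endpoint A (edge A τ) = tgt τ A) =
        Q.filter fun A => endpoint A (edge A a) = tgt a A := by
      ext A
      simp only [hQdef, Finset.mem_filter, Finset.mem_univ, true_and, Finset.forall_mem_insert]
      tauto
    rw [hset]
    calc ((Q.filter fun A => endpoint A (edge A a) = tgt a A).card : ℝ) * ((n : ℝ) ^ S.card * n)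
        = (n * ((Q.filter fun A => endpoint A (edge A a) = tgt a A).card : ℝ)) *
          (n : ℝ) ^ S.card := by ring
      _ = (Q.card : ℝ) * (n : ℝ) ^ S.card := by rw [← hsum]
      _ ≤ _ := (mul_le_mul_of_nonneg_right hle (by positivity)).trans ih'

end Exploration

/-! ### Threads are short -/

section LongThreads

variable {n k : ℕ}

/-- The transition used by the walk at time `t`. -/
def walkEdge (A : Automaton n) (w : Word k) (u : Fin n) (r : ZMod k) (t : ℕ) : Letter × Fin n :=
  (w (r + (t : ZMod k) + 1), walk A w u r t)

lemma endpoint_walkEdge (A : Automaton n) (w : Word k) (u : Fin n) (r : ZMod k) (t : ℕ) :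
    endpoint A (walkEdge A w u r t) = walk A w u r (t + 1) := rfl

lemma walk_eq_of_endpoint_eq {A B : Automaton n} {w : Word k} {u : Fin n} {r : ZMod k} {t : ℕ}
    (h : ∀ s < t, endpoint A (walkEdge A w u r s) = endpoint B (walkEdge A w u r s)) :
    walk B w u r t = walk A w u r t := by
  induction t with
  | zero => rfl
  | succ t ih =>
    have h1 := ih fun s hs => h s (by omega)
    have h2 := h t (by omega)
    rw [endpoint_walkEdge] at h2
    rw [h2, walk_succ, h1]
    rfl

lemma isAdaptive_walkEdge (w : Word k) (u : Fin n) (r : ZMod k) :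
    IsAdaptive fun A => walkEdge A w u r :=
  fun A B t h => by simp only [walkEdge]; rw [walk_eq_of_endpoint_eq h]

/-- The nodes visited by the walk up to time `t` are distinct. -/
def NoRepetition (A : Automaton n) (w : Word k) (u : Fin n) (r : ZMod k) (t : ℕ) : Prop :=
  ∀ i ≤ t, ∀ j ≤ t, (explode A w)^[i] (u, r) = (explode A w)^[j] (u, r) → i = j

lemma NoRepetition.mono {A : Automaton n} {w : Word k} {u : Fin n} {r : ZMod k} {t t' : ℕ}
    (h : NoRepetition A w u r t) (ht : t' ≤ t) : NoRepetition A w u r t' :=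
  fun i hi j hj => h i (by omega) j (by omega)

lemma noRepetition_congr {A B : Automaton n} {w : Word k} {u : Fin n} {r : ZMod k} {t : ℕ}
    (h : ∀ i ≤ t, walk B w u r i = walk A w u r i) :
    NoRepetition B w u r t ↔ NoRepetition A w u r t := by
  refine forall₂_congr fun i hi => forall₂_congr fun j hj => ?_
  rw [explode_iterate_eq_iff, explode_iterate_eq_iff, h i hi, h j hj]

open scoped Classical in
/-- The number of fresh queries of the walk between the times `t₀` and `t`. -/
noncomputable def freshCount (A : Automaton n) (w : Word k) (u : Fin n) (r : ZMod k) (t₀ t : ℕ) :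
    ℕ :=
  ((Finset.Ico t₀ t).filter fun s => IsFresh (fun A => walkEdge A w u r) A s).card

open scoped Classical in
lemma freshCount_succ (A : Automaton n) (w : Word k) (u : Fin n) (r : ZMod k) {t₀ t : ℕ}
    (ht : t₀ ≤ t) : freshCount A w u r t₀ (t + 1) = freshCount A w u r t₀ t +
      if IsFresh (fun A => walkEdge A w u r) A t then 1 else 0 := by
  have h1 : Finset.Ico t₀ (t + 1) = insert t (Finset.Ico t₀ t) := by
    ext s; simp only [Finset.mem_Ico, Finset.mem_insert]; omega
  rw [freshCount, freshCount, h1, Finset.filter_insert]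
  split_ifs with h
  · rw [Finset.card_insert_of_notMem (by simp)]
  · simp

open scoped Classical in
/-- A fresh query closes the thread for at least `a` of its possible answers. -/
lemma card_noRepetition_setEdge_le [NeZero k] {A : Automaton n} {w : Word k} {u : Fin n}
    {r : ZMod k} {a t : ℕ} (ht : k * a ≤ t) (hD : NoRepetition A w u r t)
    (hf : IsFresh (fun A => walkEdge A w u r) A t) :
    (Finset.univ.filter fun z =>
      NoRepetition (setEdge A (walkEdge A w u r t) z) w u r (t + 1)).card + a ≤ n := by
  have hk := NeZero.pos k
  set e := walkEdge A w u r t with he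
  set X : Finset (Fin n) :=
    (Finset.range a).image fun m => walk A w u r ((t + 1) % k + k * m) with hX
  have hmod := Nat.mod_lt (t + 1) hk
  have hb : ∀ m < a, (t + 1) % k + k * m ≤ t := fun m hm => by
    have := Nat.mul_le_mul_left k (show m + 1 ≤ a by omega)
    rw [mul_add, mul_one] at this
    omega
  have hXcard : X.card = a := by
    rw [hX, Finset.card_image_of_injOn, Finset.card_range]
    intro m hm m' hm' heq
    simp only [Finset.coe_range, Set.mem_Iio] at hm hm'
    have := hD _ (hb m hm) _ (hb m' hm') ((explode_iterate_eq_iff _ _ _ _ _ _).2 ⟨heq, by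
      simp [Nat.ModEq]⟩)
    exact Nat.eq_of_mul_eq_mul_left hk (by omega)
  have hdisj : Disjoint (Finset.univ.filter fun z =>
      NoRepetition (setEdge A e z) w u r (t + 1)) X := by
    rw [Finset.disjoint_left]
    intro z hz hzX
    simp only [Finset.mem_filter, Finset.mem_univ, true_and] at hz
    simp only [hX, Finset.mem_image, Finset.mem_range] at hzX
    obtain ⟨m, hm, rfl⟩ := hzX
    set B := setEdge A e (walk A w u r ((t + 1) % k + k * m)) with hB
    have hwalk : ∀ i ≤ t, walk B w u r i = walk A w u r i := fun i hi =>
      walk_eq_of_endpoint_eq fun s hs => (endpoint_setEdge_of_ne A (hf s (by omega)) _).symm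
    have hlast : walk B w u r (t + 1) = walk A w u r ((t + 1) % k + k * m) := by
      have h1 : walkEdge B w u r t = e := by rw [he, walkEdge, walkEdge, hwalk t le_rfl]
      rw [← endpoint_walkEdge, h1, hB, endpoint_setEdge_self]
    have h2 := hb m hm
    have := hz _ (by omega) (t + 1) le_rfl ((explode_iterate_eq_iff _ _ _ _ _ _).2
      ⟨(hwalk _ h2).trans hlast.symm, by simp [Nat.ModEq]⟩)
    omega
  have := Finset.card_le_univ ((Finset.univ.filter fun z =>
      NoRepetition (setEdge A e z) w u r (t + 1)) ∪ X)
  rw [Finset.card_union_of_disjoint hdisj, hXcard, Fintype.card_fin] at this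
  exact this

open scoped Classical in
-- The weight `(n / (n - a)) ^ freshCount`, killed at the first repetition, is a supermartingale
-- from time `k * a` on: a fresh query multiplies it by `n / (n - a)` but survives for at most `n -
-- a` of the `n` answers, and other queries do not increase it.
lemma sum_pow_freshCount_le [NeZero k] (w : Word k) (u : Fin n) (r : ZMod k) {a t : ℕ} (ha : a < n)
    (ht : k * a ≤ t) :
    ∑ A : Automaton n, (if NoRepetition A w u r t then
      ((n : ℝ) / (n - a)) ^ freshCount A w u r (k * a) t else 0) ≤ Fintype.card (Automaton n) := by
  have hna : (0 : ℝ) < n - a := by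
    have : (a : ℝ) < n := by exact_mod_cast ha
    linarith
  set θ : ℝ := (n : ℝ) / (n - a) with hθ
  have hθ0 : 0 ≤ θ := by positivity
  induction t, ht using Nat.le_induction with
  | base =>
    have h0 : ∀ A : Automaton n, freshCount A w u r (k * a) (k * a) = 0 := fun A => by
      simp [freshCount]
    simp only [h0, pow_zero]
    calc _ ≤ ∑ A : Automaton n, (1 : ℝ) := Finset.sum_le_sum fun A _ => by split_ifs <;> norm_num
      _ = _ := by simp
  | succ t ht ih =>
    refine le_trans ?_ ih
    set edge : Automaton n → ℕ → Letter × Fin n := fun A => walkEdge A w u r with hedge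
    have hadapt : IsAdaptive edge := isAdaptive_walkEdge w u r
    set Q : Finset (Automaton n) := Finset.univ.filter fun A =>
      NoRepetition A w u r t ∧ IsFresh edge A t with hQdef
    have hwalk : ∀ A, IsFresh edge A t → ∀ z, ∀ i ≤ t,
        walk (setEdge A (edge A t) z) w u r i = walk A w u r i := fun A hA z i hi =>
      walk_eq_of_endpoint_eq fun s hs => (endpoint_setEdge_of_ne A (hA s (by omega)) z).symm
    have hcount : ∀ A, IsFresh edge A t → ∀ z,
        freshCount (setEdge A (edge A t) z) w u r (k * a) t = freshCount A w u r (k * a) t := by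
      intro A hA z
      rw [freshCount, freshCount]
      congr 1
      refine Finset.filter_congr fun s hs => ?_
      exact hadapt.isFresh_setEdge_iff hA z (Finset.mem_Ico.1 hs).2.le
    have hQ : ∀ A ∈ Q, ∀ z, setEdge A (edge A t) z ∈ Q ∧
        edge (setEdge A (edge A t) z) t = edge A t := by
      intro A hA z
      simp only [hQdef, Finset.mem_filter, Finset.mem_univ, true_and] at hA ⊢
      exact ⟨⟨(noRepetition_congr (hwalk A hA.2 z)).2 hA.1,
        (hadapt.isFresh_setEdge_iff hA.2 z le_rfl).2 hA.2⟩, hadapt.edge_setEdge hA.2 z le_rfl⟩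
    have hsum := sum_resample Q (fun A => edge A t) hQ fun A =>
      if NoRepetition A w u r (t + 1) then θ ^ freshCount A w u r (k * a) t else 0
    have hfresh : ∑ A ∈ Q, (if NoRepetition A w u r (t + 1) then
          θ ^ freshCount A w u r (k * a) (t + 1) else 0) ≤
        ∑ A ∈ Q, θ ^ freshCount A w u r (k * a) t := by
      have h1 : ∀ A ∈ Q, (if NoRepetition A w u r (t + 1) then
          θ ^ freshCount A w u r (k * a) (t + 1) else 0) =
          θ * (if NoRepetition A w u r (t + 1) then θ ^ freshCount A w u r (k * a) t else 0) := by
        intro A hA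
        simp only [hQdef, Finset.mem_filter, Finset.mem_univ, true_and] at hA
        rw [freshCount_succ A w u r ht, if_pos hA.2]
        split_ifs
        · rw [pow_succ]; ring
        · ring
      rw [Finset.sum_congr rfl h1, ← Finset.mul_sum]
      -- Averaging over the resampled answer: the weight before time `t` is constant, and at most `n
      -- - a` answers avoid a repetition.
      have h2 : (n : ℝ) * ∑ A ∈ Q, (if NoRepetition A w u r (t + 1) then
          θ ^ freshCount A w u r (k * a) t else 0) ≤
          (n - a) * ∑ A ∈ Q, θ ^ freshCount A w u r (k * a) t := by
        rw [← hsum, Finset.mul_sum]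
        refine Finset.sum_le_sum fun A hA => ?_
        simp only [hQdef, Finset.mem_filter, Finset.mem_univ, true_and] at hA
        simp only [hcount A hA.2]
        rw [← Finset.sum_filter, Finset.sum_const, nsmul_eq_mul]
        refine mul_le_mul_of_nonneg_right ?_ (by positivity)
        have := card_noRepetition_setEdge_le ht hA.1 hA.2
        rw [le_sub_iff_add_le]
        exact_mod_cast this
      rw [hθ, div_mul_eq_mul_div, div_le_iff₀ hna]
      linarith
    rw [← Finset.sum_filter_add_sum_filter_not Finset.univ (fun A => A ∈ Q),
      ← Finset.sum_filter_add_sum_filter_not (s := Finset.univ) (p := fun A => A ∈ Q)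
        (f := fun A => if NoRepetition A w u r t then θ ^ freshCount A w u r (k * a) t else 0)]
    have hfilter : (Finset.univ.filter fun A => A ∈ Q) = Q := by ext; simp
    rw [hfilter]
    refine add_le_add (hfresh.trans_eq (Finset.sum_congr rfl fun A hA => ?_))
      (Finset.sum_le_sum fun A hA => ?_)
    · simp only [hQdef, Finset.mem_filter, Finset.mem_univ, true_and] at hA
      rw [if_pos hA.1]
    · simp only [hQdef, Finset.mem_filter, Finset.mem_univ, true_and, not_and] at hA
      by_cases h1 : NoRepetition A w u r (t + 1)
      · have h2 := h1.mono (Nat.le_succ t)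
        rw [if_pos h1, if_pos h2, freshCount_succ A w u r ht, if_neg (hA h2), add_zero]
      · rw [if_neg h1]
        split_ifs <;> positivity

open scoped Classical in
/-- A walk without repetition makes many fresh queries, since each transition can be used with at
most `k` different congruences. -/
lemma le_freshCount [NeZero k] {A : Automaton n} {w : Word k} {u : Fin n} {r : ZMod k} {t₀ : ℕ}
    (hD : NoRepetition A w u r (2 * k * t₀)) : t₀ ≤ freshCount A w u r t₀ (2 * k * t₀) := by
  have hk := NeZero.pos k
  set M := 2 * k * t₀ with hM
  set edge : Automaton n → ℕ → Letter × Fin n := fun A => walkEdge A w u r with hedge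
  have h1 : M ≤ k * ((Finset.range M).image (edge A)).card := by
    have := Finset.card_le_mul_card_image (f := edge A) (Finset.range M) k fun e _ => by
      rw [← Finset.card_range k]
      refine Finset.card_le_card_of_injOn (fun s => s % k)
        (fun s _ => by simpa using Nat.mod_lt s hk) ?_
      intro s hs s' hs' hmod
      simp only [Finset.coe_filter, Finset.mem_range, Set.mem_ofPred_eq] at hs hs'
      exact hD s (by omega) s' (by omega) ((explode_iterate_eq_iff _ _ _ _ _ _).2
        ⟨congrArg Prod.snd (hs.2.trans hs'.2.symm), hmod⟩)
    rwa [Finset.card_range] at this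
  -- Every transition is fresh when first used, so distinct transitions are bounded by fresh times.
  have h2 : (Finset.range M).image (edge A) ⊆
      ((Finset.range M).filter fun s => IsFresh edge A s).image (edge A) := by
    intro e he
    simp only [Finset.mem_image, Finset.mem_range, Finset.mem_filter] at he ⊢
    have hspec := Nat.find_spec he
    refine ⟨Nat.find he, ⟨hspec.1, fun s hs heq => ?_⟩, hspec.2⟩
    exact Nat.find_min he hs ⟨by omega, heq.trans hspec.2⟩
  have h3 : ((Finset.range M).filter fun s => IsFresh edge A s).card ≤
      t₀ + freshCount A w u r t₀ M := by
    have : ((Finset.range M).filter fun s => IsFresh edge A s) ⊆ Finset.range t₀ ∪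
        ((Finset.Ico t₀ M).filter fun s => IsFresh edge A s) := by
      intro s
      simp only [Finset.mem_filter, Finset.mem_range, Finset.mem_union, Finset.mem_Ico]
      intro hs
      by_cases h : s < t₀
      · exact Or.inl h
      · exact Or.inr ⟨⟨by omega, hs.1⟩, hs.2⟩
    refine (Finset.card_le_card this).trans ((Finset.card_union_le _ _).trans ?_)
    rw [Finset.card_range]
    rfl
  have h4 := (Finset.card_le_card h2).trans (Finset.card_image_le.trans h3)
  have h5 : k * (2 * t₀) ≤ k * (t₀ + freshCount A w u r t₀ M) := by
    calc k * (2 * t₀) = M := by rw [hM]; ring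
      _ ≤ _ := h1.trans (Nat.mul_le_mul_left k h4)
  have := Nat.le_of_mul_le_mul_left h5 hk
  omega

open scoped Classical in
-- Markov's inequality for the weight above: surviving until `2 * k * (k * a)` forces `k * a` fresh
-- queries after time `k * a`, each worth a factor at least `exp (a / n)`.
lemma card_noRepetition_le [NeZero k] (w : Word k) (u : Fin n) (r : ZMod k) {a : ℕ} (ha : a < n) :
    ((Finset.univ.filter fun A : Automaton n =>
      NoRepetition A w u r (2 * k * (k * a))).card : ℝ) ≤
      Fintype.card (Automaton n) * Real.exp (-((a : ℝ) ^ 2 / n)) := by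
  have hk := NeZero.pos k
  have hn : (0 : ℝ) < n := by exact_mod_cast (by omega : 0 < n)
  have hna : (0 : ℝ) < n - a := by
    have : (a : ℝ) < n := by exact_mod_cast ha
    linarith
  have hM : k * a ≤ 2 * k * (k * a) := Nat.le_mul_of_pos_left _ (by omega)
  have h1 := sum_pow_freshCount_le w u r ha hM
  set θ : ℝ := (n : ℝ) / (n - a) with hθ
  have hθ1 : 1 ≤ θ := by
    rw [hθ, le_div_iff₀ hna]
    have : (0 : ℝ) ≤ a := by positivity
    linarith
  have h2 : ((Finset.univ.filter fun A : Automaton n =>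
      NoRepetition A w u r (2 * k * (k * a))).card : ℝ) * θ ^ (k * a) ≤
      Fintype.card (Automaton n) := by
    refine le_trans ?_ h1
    rw [← Finset.sum_filter, ← nsmul_eq_mul, ← Finset.sum_const]
    refine Finset.sum_le_sum fun A hA => ?_
    exact pow_le_pow_right₀ hθ1 (le_freshCount (Finset.mem_filter.1 hA).2)
  have h3 : Real.exp ((a : ℝ) ^ 2 / n) ≤ θ ^ (k * a) := by
    have h4 : Real.exp ((a : ℝ) / n) ≤ θ := by
      have h5 : 1 - (a : ℝ) / n ≤ Real.exp (-((a : ℝ) / n)) := by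
        have := Real.add_one_le_exp (-((a : ℝ) / n))
        linarith
      have h6 : θ = (1 - (a : ℝ) / n)⁻¹ := by
        rw [hθ]; field_simp
      have h7 : 0 < 1 - (a : ℝ) / n := by
        rw [sub_pos, div_lt_one hn]; linarith
      rw [h6, ← inv_inv (Real.exp _), ← Real.exp_neg]
      exact inv_anti₀ h7 h5
    -- Only `a` of the `k * a` factors are needed.
    calc Real.exp ((a : ℝ) ^ 2 / n) = Real.exp ((a : ℝ) / n) ^ a := by
          rw [← Real.exp_nat_mul]; congr 1; ring
      _ ≤ θ ^ a := pow_le_pow_left₀ (Real.exp_pos _).le h4 a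
      _ ≤ θ ^ (k * a) := pow_le_pow_right₀ hθ1 (Nat.le_mul_of_pos_left a hk)
  rw [Real.exp_neg, ← div_eq_mul_inv, le_div_iff₀ (Real.exp_pos _)]
  exact (mul_le_mul_of_nonneg_left h3 (by positivity)).trans h2

end LongThreads

/-! ### Random labels of disjoint sets -/

open scoped Classical in
-- Moving the minimum of `O` from `m` to any `x ∈ O` by a transposition is injective in `(σ, x)`:
-- the result has its minimum over `O` at `x`, which reveals `x` and then `σ`.
lemma card_perm_min_mul_le {n : ℕ} {O : Finset (Fin n)} {m : Fin n} (hm : m ∈ O) :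
    (Finset.univ.filter fun σ : Equiv.Perm (Fin n) => ∀ x ∈ O, σ m ≤ σ x).card * O.card ≤
      n.factorial := by
  rw [← Finset.card_product]
  have hcard : (Finset.univ : Finset (Equiv.Perm (Fin n))).card = n.factorial := by
    rw [Finset.card_univ, Fintype.card_perm, Fintype.card_fin]
  rw [← hcard]
  refine Finset.card_le_card_of_injOn (fun y => y.1 * Equiv.swap m y.2)
    (fun _ _ => Finset.mem_coe.2 (Finset.mem_univ _)) ?_
  have key : ∀ σ : Equiv.Perm (Fin n), (∀ x ∈ O, σ m ≤ σ x) → ∀ x ∈ O, ∀ y ∈ O,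
      (σ * Equiv.swap m x) x ≤ (σ * Equiv.swap m x) y := by
    intro σ hσ x hx y hy
    simp only [Equiv.Perm.mul_apply, Equiv.swap_apply_right]
    refine hσ _ ?_
    rw [Equiv.swap_apply_def]
    split_ifs <;> assumption
  rintro ⟨σ, x⟩ hx ⟨τ, y⟩ hy heq
  simp only [Finset.coe_product, Finset.coe_filter, Finset.mem_univ, true_and, Set.mem_prod,
    Set.mem_ofPred_eq, Finset.mem_coe] at hx hy heq
  have h1 := key σ hx.1 x hx.2 y hy.2
  have h2 := key τ hy.1 y hy.2 x hx.2
  rw [← heq] at h2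
  have hxy : x = y := (σ * Equiv.swap m x).injective (le_antisymm h1 h2)
  subst hxy
  rw [mul_right_cancel heq]

open scoped Classical in
-- The transpositions in `O` and in `O'` do not interfere, so both minima can be moved independently
-- and read off from the result.
lemma card_perm_min_min_mul_le {n : ℕ} {O O' : Finset (Fin n)} (hd : Disjoint O O') {m m' : Fin n}
    (hm : m ∈ O) (hm' : m' ∈ O') :
    (Finset.univ.filter fun σ : Equiv.Perm (Fin n) =>
      (∀ x ∈ O, σ m ≤ σ x) ∧ ∀ x ∈ O', σ m' ≤ σ x).card * (O.card * O'.card) ≤ n.factorial := by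
  rw [← Finset.card_product, ← Finset.card_product]
  have hcard : (Finset.univ : Finset (Equiv.Perm (Fin n))).card = n.factorial := by
    rw [Finset.card_univ, Fintype.card_perm, Fintype.card_fin]
  rw [← hcard]
  have hne : ∀ x ∈ O, ∀ y ∈ O', x ≠ y := fun x hx y hy h =>
    Finset.disjoint_left.1 hd hx (h ▸ hy)
  refine Finset.card_le_card_of_injOn
    (fun y => y.1 * Equiv.swap m y.2.1 * Equiv.swap m' y.2.2)
    (fun _ _ => Finset.mem_coe.2 (Finset.mem_univ _)) ?_
  have swap_mem : ∀ {P : Finset (Fin n)} {p x y : Fin n}, p ∈ P → x ∈ P → y ∈ P →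
      Equiv.swap p x y ∈ P := by
    intro P p x y hp hx hy
    rw [Equiv.swap_apply_def]
    split_ifs <;> assumption
  have key : ∀ σ : Equiv.Perm (Fin n), (∀ x ∈ O, σ m ≤ σ x) → ∀ x ∈ O, ∀ x' ∈ O', ∀ y ∈ O,
      (σ * Equiv.swap m x * Equiv.swap m' x') x ≤
        (σ * Equiv.swap m x * Equiv.swap m' x') y := by
    intro σ hσ x hx x' hx' y hy
    simp only [Equiv.Perm.mul_apply]
    rw [Equiv.swap_apply_of_ne_of_ne (hne x hx m' hm') (hne x hx x' hx'),
      Equiv.swap_apply_of_ne_of_ne (hne y hy m' hm') (hne y hy x' hx'), Equiv.swap_apply_right]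
    exact hσ _ (swap_mem hm hx hy)
  have key' : ∀ σ : Equiv.Perm (Fin n), (∀ x ∈ O', σ m' ≤ σ x) → ∀ x ∈ O, ∀ x' ∈ O', ∀ y ∈ O',
      (σ * Equiv.swap m x * Equiv.swap m' x') x' ≤
        (σ * Equiv.swap m x * Equiv.swap m' x') y := by
    intro σ hσ x hx x' hx' y hy
    simp only [Equiv.Perm.mul_apply]
    have h1 := swap_mem hm' hx' hy
    rw [Equiv.swap_apply_right,
      Equiv.swap_apply_of_ne_of_ne (hne m hm m' hm').symm (hne x hx m' hm').symm,
      Equiv.swap_apply_of_ne_of_ne (hne m hm _ h1).symm (hne x hx _ h1).symm]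
    exact hσ _ h1
  rintro ⟨σ, x, x'⟩ hx ⟨τ, y, y'⟩ hy heq
  simp only [Finset.coe_product, Finset.coe_filter, Finset.mem_univ, true_and, Set.mem_prod,
    Set.mem_ofPred_eq, Finset.mem_coe] at hx hy heq
  obtain ⟨⟨hσ, hσ'⟩, hx, hx'⟩ := hx
  obtain ⟨⟨hτ, hτ'⟩, hy, hy'⟩ := hy
  have h1 := key σ hσ x hx x' hx' y hy
  have h2 := key τ hτ y hy y' hy' x hx
  have h3 := key' σ hσ' x hx x' hx' y' hy'
  have h4 := key' τ hτ' y hy y' hy' x' hx'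
  rw [← heq] at h2 h4
  have hxy : x = y := (Equiv.injective _) (le_antisymm h1 h2)
  have hxy' : x' = y' := (Equiv.injective _) (le_antisymm h3 h4)
  subst hxy hxy'
  rw [mul_right_cancel (mul_right_cancel heq)]

/-! ### Cycles of `A_w` and the position of their smallest label -/

open scoped Classical in
/-- The cycle of a periodic point. -/
noncomputable def cycleOf {α : Type*} (g : α → α) (q : α) : Finset α :=
  (Finset.range (Function.minimalPeriod g q)).image fun i => g^[i] q

lemma card_cycleOf {α : Type*} (g : α → α) (q : α) :
    (cycleOf g q).card = Function.minimalPeriod g q := by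
  classical
  rw [cycleOf, Finset.card_image_of_injOn, Finset.card_range]
  intro i hi j hj h
  simp only [Finset.coe_range, Set.mem_Iio] at hi hj
  exact (Function.iterate_eq_iterate_iff_of_lt_minimalPeriod hi hj).1 h

lemma mem_cycleOf {α : Type*} {g : α → α} {q x : α} (hq : q ∈ Function.periodicPts g) :
    x ∈ cycleOf g q ↔ ∃ i, g^[i] q = x := by
  simp only [cycleOf, Finset.mem_image, Finset.mem_range]
  constructor
  · rintro ⟨i, -, h⟩
    exact ⟨i, h⟩
  · rintro ⟨i, rfl⟩
    exact ⟨i % Function.minimalPeriod g q,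
      Nat.mod_lt _ (Function.minimalPeriod_pos_of_mem_periodicPts hq),
      Function.iterate_mod_minimalPeriod_eq⟩

lemma IsCycleMin.le_of_mem_cycleOf {n k : ℕ} {A : Automaton n} {w : Word k}
    {σ : Equiv.Perm (Fin n)} {q : Fin n} (hq : q ∈ Function.periodicPts (inducedMap A w)) {a : ℕ}
    (h : IsCycleMin A w σ ((inducedMap A w)^[a] q)) {x : Fin n}
    (hx : x ∈ cycleOf (inducedMap A w) q) : σ ((inducedMap A w)^[a] q) ≤ σ x := by
  obtain ⟨i, rfl⟩ := (mem_cycleOf hq).1 hx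
  obtain ⟨m, hm⟩ := exists_iterate_of_periodic hq (m := a) rfl
  have := h.2 (i + m)
  rwa [Function.iterate_add_apply, hm] at this

open scoped Classical in
lemma card_isCycleMin_mul_le {n k : ℕ} (A : Automaton n) (w : Word k) {q : Fin n}
    (hq : q ∈ Function.periodicPts (inducedMap A w)) (a : ℕ) :
    (Finset.univ.filter fun σ : Equiv.Perm (Fin n) =>
      IsCycleMin A w σ ((inducedMap A w)^[a] q)).card *
        Function.minimalPeriod (inducedMap A w) q ≤ n.factorial := by
  have h := card_perm_min_mul_le ((mem_cycleOf hq).2 ⟨a, rfl⟩)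
  rw [card_cycleOf] at h
  refine le_trans (Nat.mul_le_mul_right _ (Finset.card_le_card fun σ hσ => ?_)) h
  simp only [Finset.mem_filter, Finset.mem_univ, true_and] at hσ ⊢
  exact fun x hx => hσ.le_of_mem_cycleOf hq hx

open scoped Classical in
lemma card_isCycleMin_isCycleMin_mul_le {n k : ℕ} (A : Automaton n) (w : Word k) {q q' : Fin n}
    (hq : q ∈ Function.periodicPts (inducedMap A w))
    (hq' : q' ∈ Function.periodicPts (inducedMap A w))
    (hne : ∀ i, (inducedMap A w)^[i] q ≠ q') (a a' : ℕ) :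
    (Finset.univ.filter fun σ : Equiv.Perm (Fin n) =>
      IsCycleMin A w σ ((inducedMap A w)^[a] q) ∧
      IsCycleMin A w σ ((inducedMap A w)^[a'] q')).card *
        (Function.minimalPeriod (inducedMap A w) q * Function.minimalPeriod (inducedMap A w) q') ≤
      n.factorial := by
  have hd : Disjoint (cycleOf (inducedMap A w) q) (cycleOf (inducedMap A w) q') := by
    rw [Finset.disjoint_left]
    intro x hx hx'
    obtain ⟨i, rfl⟩ := (mem_cycleOf hq).1 hx
    obtain ⟨j, hj⟩ := (mem_cycleOf hq').1 hx'
    obtain ⟨m, hm⟩ := exists_iterate_of_periodic hq' hj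
    exact hne (m + i) (by rw [Function.iterate_add_apply, hm])
  have h := card_perm_min_min_mul_le hd ((mem_cycleOf hq).2 ⟨a, rfl⟩) ((mem_cycleOf hq').2 ⟨a', rfl⟩)
  rw [card_cycleOf, card_cycleOf] at h
  refine le_trans (Nat.mul_le_mul_right _ (Finset.card_le_card fun σ hσ => ?_)) h
  simp only [Finset.mem_filter, Finset.mem_univ, true_and] at hσ ⊢
  exact ⟨fun x hx => hσ.1.le_of_mem_cycleOf hq hx, fun x hx => hσ.2.le_of_mem_cycleOf hq' hx⟩

/-! ### Exploring three walks one after the other -/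

section ThreeWalks

variable {n k : ℕ}

/-- The queries of `M` steps of the walks from `(q, 0)`, from `(q', 0)`, and from `(x, r)`, where `x`
is the vertex of the second walk at time `i'`. -/
def threeWalks (w : Word k) (q q' : Fin n) (i' : ℕ) (r : ZMod k) (M : ℕ) (A : Automaton n)
    (t : ℕ) : Letter × Fin n :=
  if t < M then walkEdge A w q 0 t
  else if t < 2 * M then walkEdge A w q' 0 (t - M)
  else walkEdge A w (walk A w q' 0 i') r (t - 2 * M)

variable {w : Word k} {q q' : Fin n} {i' : ℕ} {r : ZMod k} {M : ℕ} {A : Automaton n}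

lemma threeWalks_first {t : ℕ} (ht : t < M) :
    threeWalks w q q' i' r M A t = walkEdge A w q 0 t := if_pos ht

lemma threeWalks_second {t : ℕ} (ht : t < M) :
    threeWalks w q q' i' r M A (M + t) = walkEdge A w q' 0 t := by
  rw [threeWalks, if_neg (by omega), if_pos (by omega), Nat.add_sub_cancel_left]

lemma threeWalks_third (t : ℕ) :
    threeWalks w q q' i' r M A (2 * M + t) = walkEdge A w (walk A w q' 0 i') r t := by
  rw [threeWalks, if_neg (by omega), if_neg (by omega), Nat.add_sub_cancel_left]

/-- Two automata that answer the first `τ` queries in the same way share the first `i` steps of the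
first walk. -/
lemma walk_eq_of_threeWalks {B : Automaton n} {τ : ℕ}
    (h : ∀ s < τ, endpoint A (threeWalks w q q' i' r M A s) =
      endpoint B (threeWalks w q q' i' r M A s)) {i : ℕ} (hi : i ≤ τ) (hiM : i ≤ M) :
    walk B w q 0 i = walk A w q 0 i :=
  walk_eq_of_endpoint_eq fun s hs => by
    have := h s (by omega)
    rwa [threeWalks_first (by omega)] at this

/-- The condition `i' ≤ M` makes the starting vertex of the third walk known before its first query
at time `2 * M`. -/
lemma isAdaptive_threeWalks (hi' : i' ≤ M) : IsAdaptive (threeWalks w q q' i' r M) := by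
  intro A B t h
  by_cases h1 : t < M
  · rw [threeWalks_first h1, threeWalks_first h1, walkEdge, walkEdge,
      walk_eq_of_threeWalks h le_rfl h1.le]
  push Not at h1
  have hq' : ∀ i ≤ M, i ≤ t - M → walk B w q' 0 i = walk A w q' 0 i := fun i hi hi2 =>
    walk_eq_of_endpoint_eq fun s hs => by
      have := h (M + s) (by omega)
      rwa [threeWalks_second (by omega)] at this
  by_cases h2 : t < 2 * M
  · obtain ⟨t, rfl⟩ := Nat.exists_eq_add_of_le h1
    rw [threeWalks_second (by omega), threeWalks_second (by omega), walkEdge, walkEdge,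
      hq' t (by omega) (by omega)]
  · push Not at h2
    obtain ⟨t, rfl⟩ := Nat.exists_eq_add_of_le h2
    have hx := hq' i' hi' (by omega)
    rw [threeWalks_third, threeWalks_third, hx, walkEdge, walkEdge, walk_eq_of_endpoint_eq]
    intro s hs
    have := h (2 * M + s) (by omega)
    rwa [threeWalks_third] at this

/-- The first query with a property of the transition is automatically fresh, since an earlier
identical query would have the property too. -/
lemma exists_first_isFresh {edge : Automaton n → ℕ → Letter × Fin n} {A : Automaton n}
    (P : Letter × Fin n → Prop) {t : ℕ} (h : P (edge A t)) :
    ∃ τ ≤ t, P (edge A τ) ∧ IsFresh edge A τ := by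
  classical
  have hex : ∃ t, P (edge A t) := ⟨t, h⟩
  refine ⟨Nat.find hex, Nat.find_min' hex h, Nat.find_spec hex, fun s hs heq => ?_⟩
  exact Nat.find_min hex hs (heq ▸ Nat.find_spec hex)

/-- The query at time `τ` is fresh and its answer is `z`. -/
def IsHit (edge : Automaton n → ℕ → Letter × Fin n) (A : Automaton n) (τ : ℕ) (z : Fin n) : Prop :=
  IsFresh edge A τ ∧ endpoint A (edge A τ) = z

/-- If the first walk is closed and a vertex `z` at the start of it is entered by two different
transitions, then there are two different fresh queries with prescribed answers. -/
lemma exists_two_hits {N L i t₂ : ℕ} (hNM : N ≤ M) (hL : 1 ≤ L) (hLM : L ≤ M)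
    (hclose : walk A w q 0 L = q) (hi : 1 ≤ i) (hiN : i ≤ N) (ht₂ : t₂ < 3 * M)
    (hne : threeWalks w q q' i' r M A t₂ ≠ threeWalks w q q' i' r M A (i - 1))
    (hz : endpoint A (threeWalks w q q' i' r M A t₂) = walk A w q 0 i) :
    ∃ τ₁ < L, ∃ i₀ ≤ N, ∃ τ₂ < 3 * M, τ₁ ≠ τ₂ ∧ i₀ ≤ τ₂ ∧
      IsHit (threeWalks w q q' i' r M) A τ₁ q ∧
      IsHit (threeWalks w q q' i' r M) A τ₂ (walk A w q 0 i₀) := by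
  classical
  set edge := threeWalks w q q' i' r M with hedge
  have hland : ∀ t < M, endpoint A (edge A t) = walk A w q 0 (t + 1) := fun t ht => by
    rw [hedge, threeWalks_first ht, endpoint_walkEdge]
  obtain ⟨τ₁, hτ₁, hτ₁q, hτ₁f⟩ := exists_first_isFresh (edge := edge) (A := A) (t := L - 1)
    (fun e => endpoint A e = q) (by rw [hland _ (by omega), Nat.sub_add_cancel hL, hclose])
  -- The target is named by the first visit time `i₀` of the first walk, so that it is known when
  -- the second hit occurs. The second hit is the first use of a transition into it other than the
  -- one behind the first hit (`i₀ = 0`) or behind the first visit (`i₀ > 0`).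
  have hex : ∃ i₀, walk A w q 0 i₀ = walk A w q 0 i := ⟨i, rfl⟩
  set i₀ := Nat.find hex with hi₀
  have hi₀z : walk A w q 0 i₀ = walk A w q 0 i := Nat.find_spec hex
  have hi₀i : i₀ ≤ i := Nat.find_min' hex rfl
  have hzi : endpoint A (edge A (i - 1)) = walk A w q 0 i := by
    rw [hland _ (by omega), Nat.sub_add_cancel hi]
  have hfirst : ∀ h : Letter × Fin n, ∃ τ < 3 * M, (endpoint A (edge A τ) = walk A w q 0 i ∧
      edge A τ ≠ h) ∧ IsFresh edge A τ := by
    intro h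
    by_cases h1 : edge A t₂ = h
    · obtain ⟨τ, hτ, h2, h3⟩ := exists_first_isFresh (edge := edge) (A := A) (t := i - 1)
        (fun e => endpoint A e = walk A w q 0 i ∧ e ≠ h) ⟨hzi, h1 ▸ hne.symm⟩
      exact ⟨τ, by omega, h2, h3⟩
    · obtain ⟨τ, hτ, h2, h3⟩ := exists_first_isFresh (edge := edge) (A := A) (t := t₂)
        (fun e => endpoint A e = walk A w q 0 i ∧ e ≠ h) ⟨hz, h1⟩
      exact ⟨τ, by omega, h2, h3⟩
  rcases Nat.eq_zero_or_pos i₀ with h0 | hpos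
  · obtain ⟨τ₂, hτ₂, ⟨h1, h2⟩, h3⟩ := hfirst (edge A τ₁)
    exact ⟨τ₁, by omega, i₀, by omega, τ₂, hτ₂, fun h => h2 (by rw [h]), by omega,
      ⟨hτ₁f, hτ₁q⟩, h3, h1.trans hi₀z.symm⟩
  · obtain ⟨τ₂, hτ₂, ⟨h1, h2⟩, h3⟩ := hfirst (edge A (i₀ - 1))
    refine ⟨τ₁, by omega, i₀, by omega, τ₂, hτ₂, fun h => ?_, ?_,
      ⟨hτ₁f, hτ₁q⟩, h3, h1.trans hi₀z.symm⟩
    · refine Nat.find_min hex hpos ?_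
      rw [← h1, ← h, hτ₁q]
      rfl
    -- A hit before time `i₀` takes place on the first walk, which does not meet the target before
    -- `i₀`; so `τ₂ = i₀ - 1`, the excluded transition.
    · by_contra hlt
      push Not at hlt
      rw [hland τ₂ (by omega)] at h1
      have h4 : i₀ ≤ τ₂ + 1 := Nat.find_min' hex h1
      exact h2 (by congr 1; omega)

end ThreeWalks

/-! ### Automata without good cycles contain a rare configuration -/

section Configurations

variable {n k : ℕ}

/-- Two fresh hits in the exploration of a cycle and of a walk that starts on it. -/
def IsSingleConfig (w : Word k) (M : ℕ) (A : Automaton n) (σ : Equiv.Perm (Fin n)) (q : Fin n)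
    (j : ℕ) (r : ZMod k) (i₀ τ₁ τ₂ : ℕ) : Prop :=
  q ∈ Function.periodicPts (inducedMap A w) ∧ IsCycleMin A w σ ((inducedMap A w)^[2] q) ∧
  τ₁ < k * Function.minimalPeriod (inducedMap A w) q ∧ τ₁ ≠ τ₂ ∧ i₀ ≤ τ₂ ∧
  IsHit (threeWalks w q q (k * j) r M) A τ₁ q ∧
  IsHit (threeWalks w q q (k * j) r M) A τ₂ (walk A w q 0 i₀)

/-- Three fresh hits in the exploration of two cycles and of a walk that starts on one of them. -/
def IsDoubleConfig (w : Word k) (M : ℕ) (A : Automaton n) (σ : Equiv.Perm (Fin n)) (q q' : Fin n)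
    (j : ℕ) (r : ZMod k) (i₀ τ₁ τ₂ τ₃ : ℕ) : Prop :=
  q ∈ Function.periodicPts (inducedMap A w) ∧ q' ∈ Function.periodicPts (inducedMap A w) ∧
  (∀ i, (inducedMap A w)^[i] q ≠ q') ∧
  IsCycleMin A w σ ((inducedMap A w)^[2] q) ∧ IsCycleMin A w σ ((inducedMap A w)^[1] q') ∧
  τ₁ < k * Function.minimalPeriod (inducedMap A w) q ∧
  τ₃ < k * Function.minimalPeriod (inducedMap A w) q' ∧
  τ₁ ≠ τ₂ ∧ τ₁ ≠ M + τ₃ ∧ τ₂ ≠ M + τ₃ ∧ i₀ ≤ τ₂ ∧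
  IsHit (threeWalks w q q' (k * j) r M) A τ₁ q ∧
  IsHit (threeWalks w q q' (k * j) r M) A τ₂ (walk A w q 0 i₀) ∧
  IsHit (threeWalks w q q' (k * j) r M) A (M + τ₃) q'

/-- A walk that enters a vertex of a cycle with the wrong congruence has used, shortly before, a
transition that differs from the one of the cycle. -/
lemma exists_divergence [NeZero k] {w : Word k} (hw : ¬ IsSelfConjugate w) {A : Automaton n}
    {q x : Fin n} {r s : ZMod k} {i₁ m : ℕ} (hi₁ : k ∣ i₁) (hki : k ≤ i₁)
    (h : (explode A w)^[m] (x, r) = (walk A w q 0 i₁, s)) (hs : s ≠ 0) :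
    (∃ d < k, d < m ∧ walkEdge A w x r (m - d - 1) ≠ walkEdge A w q 0 (i₁ - d - 1) ∧
      walk A w x r (m - d) = walk A w q 0 (i₁ - d)) ∨ (m < k ∧ x = walk A w q 0 (i₁ - m)) := by
  by_contra hcon
  push Not at hcon
  obtain ⟨hcon₁, hcon₂⟩ := hcon
  rw [explode_iterate, Prod.mk.injEq] at h
  obtain ⟨hvert, hsum⟩ := h
  have key : ∀ d, d ≤ k → d ≤ m → walk A w x r (m - d) = walk A w q 0 (i₁ - d) := by
    intro d
    induction d with
    | zero => intro _ _; exact hvert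
    | succ d ih =>
      intro h1 h2
      by_contra hne
      refine hcon₁ d (by omega) (by omega) (fun heq => hne ?_) (ih (by omega) (by omega))
      exact (Prod.mk.inj heq).2
  have hletter : ∀ d, d < k → d < m → w (s - d) = w (-d) := by
    intro d hd hdm
    by_contra hne
    refine hcon₁ d hd hdm (fun heq => hne ?_) (key d hd.le hdm.le)
    have h1 := (Prod.mk.inj heq).1
    have e1 : r + ((m - d - 1 : ℕ) : ZMod k) + 1 = s - d := by
      have : ((m - d - 1 : ℕ) : ZMod k) = (m : ZMod k) - d - 1 := by
        rw [Nat.sub_sub, Nat.cast_sub (by omega)]; push_cast; ring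
      rw [this, ← hsum]; ring
    have e2 : (0 : ZMod k) + ((i₁ - d - 1 : ℕ) : ZMod k) + 1 = -d := by
      have : ((i₁ - d - 1 : ℕ) : ZMod k) = (i₁ : ZMod k) - d - 1 := by
        rw [Nat.sub_sub, Nat.cast_sub (by omega)]; push_cast; ring
      rw [this, (ZMod.natCast_eq_zero_iff i₁ k).2 hi₁]; ring
    rwa [e1, e2] at h1
  by_cases hmk : m < k
  · have := key m hmk.le le_rfl
    rw [Nat.sub_self] at this
    exact hcon₂ hmk this
  -- All `k` backward transitions agree, so their letters agree at every residue and `w` is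
  -- invariant under the shift by `s`.
  · refine hw ⟨s, hs, fun j => ?_⟩
    have h1 := hletter (-j).val (ZMod.val_lt _) (lt_of_lt_of_le (ZMod.val_lt _) (by omega))
    rw [ZMod.natCast_zmod_val] at h1
    rw [sub_neg_eq_add, neg_neg, add_comm] at h1
    exact h1

/-! ### Automata in which every walk repeats a node by time `M` -/

section ShortThreads

variable {w : Word k} {A : Automaton n} {M : ℕ}

lemma minimalPeriod_le (hM : ∀ u r, ¬ NoRepetition A w u r M) {o : Fin n × ZMod k}
    (ho : o ∈ Function.periodicPts (explode A w)) :
    Function.minimalPeriod (explode A w) o ≤ M := by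
  by_contra hlt
  push Not at hlt
  obtain ⟨u, r⟩ := o
  refine hM u r fun i hi j hj hij => ?_
  exact (Function.iterate_eq_iterate_iff_of_lt_minimalPeriod (by omega) (by omega)).1 hij

/-- A walk longer than `M` contains a loop of nodes; cutting it out keeps the end and leaves a
positive length. -/
lemma exists_short_iterate (hM : ∀ u r, ¬ NoRepetition A w u r M) {o p : Fin n × ZMod k} {m : ℕ}
    (hm : 1 ≤ m) (h : (explode A w)^[m] o = p) : ∃ m', 1 ≤ m' ∧ m' ≤ M ∧
      (explode A w)^[m'] o = p := by
  induction m using Nat.strong_induction_on with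
  | _ m ih =>
    by_cases hmM : m ≤ M
    · exact ⟨m, hm, hmM, h⟩
    push Not at hmM
    obtain ⟨i, j, hij, hjM, heq⟩ : ∃ i j, i < j ∧ j ≤ M ∧
        (explode A w)^[i] o = (explode A w)^[j] o := by
      have := hM o.1 o.2
      simp only [NoRepetition] at this
      push Not at this
      obtain ⟨i, hi, j, hj, h1, h2⟩ := this
      rcases lt_or_gt_of_ne h2 with h3 | h3
      · exact ⟨i, j, h3, hj, h1⟩
      · exact ⟨j, i, h3, hi, h1.symm⟩
    refine ih (m - j + i) (by omega) (by omega) ?_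
    rw [Function.iterate_add_apply, heq, ← Function.iterate_add_apply,
      Nat.sub_add_cancel (by omega), h]

lemma mul_minimalPeriod_le [NeZero k] (hM : ∀ u r, ¬ NoRepetition A w u r M) {q : Fin n}
    (hq : q ∈ Function.periodicPts (inducedMap A w)) :
    k * Function.minimalPeriod (inducedMap A w) q ≤ M := by
  have hper := (periodic_explode_iff A w q).2 hq
  refine le_trans ?_ (minimalPeriod_le hM hper)
  have h1 := Function.isPeriodicPt_minimalPeriod (explode A w) (q, (0 : ZMod k))
  obtain ⟨m, hm⟩ := dvd_of_isPeriodicPt A w h1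
  have hpos := Function.minimalPeriod_pos_of_mem_periodicPts hper
  rw [hm] at h1 hpos ⊢
  have h2 : (explode A w)^[k * m] (q, 0) = (q, 0) := h1
  rw [explode_iterate_mul] at h2
  have h3 : Function.IsPeriodicPt (inducedMap A w) m q := (Prod.mk.inj h2).1
  refine Nat.mul_le_mul_left k (h3.minimalPeriod_le ?_)
  exact Nat.pos_of_mul_pos_left hpos

end ShortThreads

/-- The base lies two `w`-transitions before the cycle minimum, so `y` is at time `k` or `2 * k` on
the walk from `(q, 0)` and `k` letters are available to look back. -/
lemma exists_base_of_mem_specialVertices {A : Automaton n} {w : Word k} {σ : Equiv.Perm (Fin n)}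
    {y : Fin n} (hy : y ∈ specialVertices A w σ) :
    ∃ q ∈ Function.periodicPts (inducedMap A w), IsCycleMin A w σ ((inducedMap A w)^[2] q) ∧
      ∃ j, 1 ≤ j ∧ j ≤ 2 ∧ (inducedMap A w)^[j] q = y := by
  have hsurj := (Function.bijOn_periodicPts (inducedMap A w)).surjOn
  obtain ⟨hper, h⟩ := hy
  obtain ⟨q, hq, rfl⟩ := hsurj hper
  rcases h with h | h
  · obtain ⟨q', hq', rfl⟩ := hsurj hq
    exact ⟨q', hq', h, 2, by omega, le_rfl, rfl⟩
  · exact ⟨q, hq, h, 1, le_rfl, by omega, rfl⟩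

/-- A bad return produces a divergence from the cycle of the target, hence two hits. If the start of
the return has a different base, the closing of its own cycle is a third hit. -/
lemma exists_config [NeZero k] {w : Word k} (hw : ¬ IsSelfConjugate w) {A : Automaton n}
    {σ : Equiv.Perm (Fin n)} {M : ℕ} (hkM : 2 * k ≤ M) (hM : ∀ u r, ¬ NoRepetition A w u r M)
    (hbad : (A, σ) ∉ cycleGood n w) :
    (∃ (q : Fin n) (j : Fin 3) (r : ZMod k) (i₀ : Fin (2 * k + 1)) (τ₁ : Fin M) (τ₂ : Fin (3 * M)),
      IsSingleConfig w M A σ q j r i₀ τ₁ τ₂) ∨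
    (∃ (q q' : Fin n) (j : Fin 3) (r : ZMod k) (i₀ : Fin (2 * k + 1)) (τ₁ : Fin M)
      (τ₂ : Fin (3 * M)) (τ₃ : Fin M), IsDoubleConfig w M A σ q q' j r i₀ τ₁ τ₂ τ₃) := by
  set g := inducedMap A w with hg
  have hk := NeZero.pos k
  have hLMall : ∀ q ∈ Function.periodicPts g, k * Function.minimalPeriod g q ≤ M :=
    fun q hq => mul_minimalPeriod_le hM hq
  -- a divergence from the cycle of `q` yields two hits
  have hits : ∀ (q q' : Fin n) (j jx m : ℕ) (r s : ZMod k), q ∈ Function.periodicPts g →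
      1 ≤ j → j ≤ 2 → 1 ≤ m → m ≤ M →
      (explode A w)^[m] (g^[jx] q', r) = (g^[j] q, s) → s ≠ 0 →
      (m < k → g^[jx] q' ≠ walk A w q 0 (k * j - m)) →
      ∃ τ₁ < k * Function.minimalPeriod g q, ∃ i₀ ≤ 2 * k, ∃ τ₂ < 3 * M, τ₁ ≠ τ₂ ∧ i₀ ≤ τ₂ ∧
        IsHit (threeWalks w q q' (k * jx) r M) A τ₁ q ∧
        IsHit (threeWalks w q q' (k * jx) r M) A τ₂ (walk A w q 0 i₀) := by
    intro q q' j jx m r s hq hj hj2 hm hmM h hs hstart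
    have hkj : k ≤ k * j := Nat.le_mul_of_pos_right k hj
    have hkj2 : k * j ≤ 2 * k := by rw [mul_comm 2 k]; exact Nat.mul_le_mul_left k hj2
    rw [hg, ← walk_mul A w q j] at h
    have hx : walk A w q' 0 (k * jx) = g^[jx] q' := walk_mul A w q' jx
    rcases exists_divergence hw (dvd_mul_right k j) hkj h hs with ⟨d, hd, hdm, hne, hv⟩ | ⟨h1, h2⟩
    · have hpos := Function.minimalPeriod_pos_of_mem_periodicPts hq
      have hLM := hLMall _ hq
      refine exists_two_hits (N := 2 * k) (i := k * j - d) (t₂ := 2 * M + (m - d - 1)) hkM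
        (Nat.mul_pos hk hpos) hLM ?_ (by omega) (by omega) (by omega) ?_ ?_
      · rw [walk_mul]
        exact Function.isPeriodicPt_minimalPeriod g q
      · rw [threeWalks_third, threeWalks_first (by omega), hx]
        exact hne
      · rw [threeWalks_third, endpoint_walkEdge, hx, ← hv]
        congr 1
        omega
    · exact absurd h2 (hstart h1)
  -- A special vertex periodic at a wrong congruence returns to itself in at least `k` steps, which
  -- excludes the short alternative of the divergence. Otherwise periodic walks from `(q, 0)` meet
  -- special vertices only at multiples of `k`, which excludes it for every return.
  by_cases hcase : ∃ y ∈ specialVertices A w σ, ∃ s : ZMod k, s ≠ 0 ∧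
      (y, s) ∈ Function.periodicPts (explode A w)
  · left
    obtain ⟨y, hy, s, hs, hper⟩ := hcase
    obtain ⟨q, hq, hmin, j, hj, hj2, rfl⟩ := exists_base_of_mem_specialVertices hy
    have h1 := Function.isPeriodicPt_minimalPeriod (explode A w) (g^[j] q, s)
    have hpos := Function.minimalPeriod_pos_of_mem_periodicPts hper
    have hle := Nat.le_of_dvd hpos (dvd_of_isPeriodicPt A w h1)
    obtain ⟨τ₁, hτ₁, i₀, hi₀, τ₂, hτ₂, h2, h3, h4, h5⟩ := hits q q j j _ s s hq hj hj2 hpos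
      (minimalPeriod_le hM hper) h1 hs fun h => absurd hle (by omega)
    have := hLMall _ hq
    exact ⟨q, ⟨j, by omega⟩, s, ⟨i₀, by omega⟩, ⟨τ₁, by omega⟩, ⟨τ₂, hτ₂⟩, hq, hmin, hτ₁, h2, h3,
      h4, h5⟩
  · push Not at hcase
    have hbad' : ∃ x ∈ specialVertices A w σ, ∃ y ∈ specialVertices A w σ, ∃ r s : ZMod k,
        ∃ m, 1 ≤ m ∧ (explode A w)^[m] (x, r) = (y, s) ∧ s ≠ 0 := by
      by_contra hcon
      push Not at hcon
      exact hbad fun x hx y hy r s m hm h => hcon x hx y hy r s m hm h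
    obtain ⟨x, hx, y, hy, r, s, m₀, hm₀, h₀, hs⟩ := hbad'
    obtain ⟨m, hm, hmM, h⟩ := exists_short_iterate hM hm₀ h₀
    obtain ⟨q, hq, hmin, j, hj, hj2, rfl⟩ := exists_base_of_mem_specialVertices hy
    obtain ⟨qx, hqx, hminx, jx, hjx, hjx2, hqjx⟩ := exists_base_of_mem_specialVertices hx
    -- special vertices are visited by periodic walks only with congruence `0`
    have hvisit : ∀ z ∈ specialVertices A w σ, ∀ t, walk A w q 0 t = z → k ∣ t := by
      intro z hz t ht
      rw [← ZMod.natCast_eq_zero_iff]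
      by_contra hne
      refine hcase z hz (t : ZMod k) hne ?_
      have := iterate_mem_periodicPts ((periodic_explode_iff A w q).2 hq) t
      rwa [explode_iterate, ht, zero_add] at this
    have hstart : m < k → x ≠ walk A w q 0 (k * j - m) := by
      intro hmk heq
      have hkj : k ≤ k * j := Nat.le_mul_of_pos_right k hj
      have h1 := hvisit x hx _ heq.symm
      have h2 := (Nat.dvd_sub_iff_right (by omega) (dvd_mul_right k j)).1 h1
      have := Nat.le_of_dvd (by omega) h2
      omega
    have hLM := hLMall _ hq
    by_cases hqq : qx = q
    · left
      subst hqq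
      rw [← hqjx] at h hstart
      obtain ⟨τ₁, hτ₁, i₀, hi₀, τ₂, hτ₂, h2, h3, h4, h5⟩ := hits qx qx j jx m r s hq hj hj2 hm hmM
        h hs hstart
      exact ⟨qx, ⟨jx, by omega⟩, r, ⟨i₀, by omega⟩, ⟨τ₁, by omega⟩, ⟨τ₂, hτ₂⟩, hq, hmin, hτ₁, h2, h3,
        h4, h5⟩
    · right
      -- The second base is taken one `w`-transition later than `qx`: being the predecessor of a
      -- minimum, `q'` is special, which is what keeps the walk from `q` away from it.
      set q' := g qx with hq'
      have hq'per : q' ∈ Function.periodicPts g := iterate_mem_periodicPts hqx 1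
      have hq'spec : q' ∈ specialVertices A w σ := ⟨hq'per, Or.inr hminx⟩
      have hx' : g^[jx - 1] q' = x := by
        rw [hq', ← Function.iterate_succ_apply, Nat.succ_eq_add_one, Nat.sub_add_cancel hjx, hqjx]
      have horbit : ∀ i, g^[i] q ≠ q' := by
        intro i hi
        refine hqq ?_
        have hin : g^[2] qx ∈ cycleOf g q := (mem_cycleOf hq).2 ⟨1 + i, by
          rw [Function.iterate_add_apply, hi]; rfl⟩
        have hin' : g^[2] q ∈ cycleOf g qx := by
          have hi1 : g^[i] q = g^[1] qx := hi
          obtain ⟨a, ha⟩ := exists_iterate_of_periodic hq hi1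
          refine (mem_cycleOf hqx).2 ⟨2 + (a + 1), ?_⟩
          rw [Function.iterate_add_apply, Function.iterate_add_apply, ha]
        have h1 := hmin.le_of_mem_cycleOf hq hin
        have h2 := hminx.le_of_mem_cycleOf hqx hin'
        have h3 : g^[2] q = g^[2] qx := σ.injective (le_antisymm h1 h2)
        have hinj := (Function.bijOn_periodicPts g).injOn
        have h4 : g q = g qx :=
          hinj (iterate_mem_periodicPts hq 1) (iterate_mem_periodicPts hqx 1) h3
        exact (hinj hq hqx h4).symm
      have hnever : ∀ t, walk A w q 0 t ≠ q' := by
        intro t ht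
        obtain ⟨i, rfl⟩ := hvisit q' hq'spec t ht
        rw [walk_mul] at ht
        exact horbit i ht
      rw [← hx'] at h hstart
      obtain ⟨τ₁, hτ₁, i₀, hi₀, τ₂, hτ₂, h2, h3, h4, h5⟩ := hits q q' j (jx - 1) m r s hq hj hj2 hm
        hmM h hs hstart
      have hLM' := hLMall _ hq'per
      have hpos' := Nat.mul_pos hk (Function.minimalPeriod_pos_of_mem_periodicPts hq'per)
      set edge := threeWalks w q q' (k * (jx - 1)) r M with hedge
      obtain ⟨τ, hτ, hτq', hτf⟩ := exists_first_isFresh (edge := edge) (A := A)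
        (t := M + (k * Function.minimalPeriod g q' - 1)) (fun e => endpoint A e = q') (by
          rw [hedge, threeWalks_second (by omega), endpoint_walkEdge,
            Nat.sub_add_cancel (by omega), walk_mul]
          exact Function.isPeriodicPt_minimalPeriod g q')
      -- The first walk avoids `q'`, so the first entry to `q'` occurs on the second walk; the
      -- targets `q` and `walk A w q 0 i₀` differ from `q'` for the same reason.
      have hMτ : M ≤ τ := by
        by_contra hlt
        rw [hedge, threeWalks_first (by omega), endpoint_walkEdge] at hτq'
        exact hnever _ hτq'
      obtain ⟨τ₃, rfl⟩ := Nat.exists_eq_add_of_le hMτ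
      have hτ₃ : τ₃ < k * Function.minimalPeriod g q' := by omega
      refine ⟨q, q', ⟨jx - 1, by omega⟩, r, ⟨i₀, by omega⟩, ⟨τ₁, by omega⟩, ⟨τ₂, hτ₂⟩,
        ⟨τ₃, by omega⟩, hq, hq'per, horbit, hmin, hminx, hτ₁, hτ₃, h2, ?_, ?_, h3,
        h4, h5, hτf, hτq'⟩
      · intro heq
        simp only at heq
        rw [← heq, h4.2] at hτq'
        exact hnever 0 hτq'
      · intro heq
        simp only at heq
        rw [← heq, h5.2] at hτq'
        exact hnever _ hτq'

end Configurations

/-! ### Counting the rare configurations -/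

section Counting

variable {n k : ℕ}

lemma card_pairs_le {α β : Type*} (H : Finset α) {c : ℝ} (X : Finset (α × β))
    (hX : ∀ x ∈ X, x.1 ∈ H)
    (hc : ∀ a ∈ H, ∃ S : Finset β, (S.card : ℝ) ≤ c ∧ ∀ b, (a, b) ∈ X → b ∈ S) :
    (X.card : ℝ) ≤ H.card * c := by
  classical
  choose! S hS hXS using hc
  have h1 : X ⊆ (H.sigma S).map (Equiv.sigmaEquivProd α β).toEmbedding := by
    rintro ⟨a, b⟩ hx
    simp only [Finset.mem_map_equiv, Finset.mem_sigma]
    exact ⟨hX _ hx, hXS a (hX _ hx) b hx⟩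
  have h2 := Finset.card_le_card h1
  rw [Finset.card_map, Finset.card_sigma] at h2
  calc (X.card : ℝ) ≤ ∑ a ∈ H, ((S a).card : ℝ) := by exact_mod_cast h2
    _ ≤ ∑ a ∈ H, c := Finset.sum_le_sum hS
    _ = H.card * c := by rw [Finset.sum_const, nsmul_eq_mul]

/-- If a cycle has length `L` with `τ < k L`, then `1 / L ≤ k / (τ + 1)`. -/
lemma inv_le_of_lt_mul {L τ : ℕ} (h : τ < k * L) :
    (1 : ℝ) / L ≤ k / (τ + 1) := by
  have hL : 0 < L := Nat.pos_of_ne_zero fun h0 => by simp [h0] at h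
  rw [div_le_div_iff₀ (by exact_mod_cast hL) (by positivity), one_mul]
  exact_mod_cast h

open scoped Classical in
-- Two fresh hits cost `n ^ 2`. For fixed `A`, the label condition costs the cycle length, which
-- exceeds `τ₁ / k`.
lemma card_singleConfig_le [NeZero n] (w : Word k) {M : ℕ} (hkM : 2 * k ≤ M) (q : Fin n)
    {j : ℕ} (hj : j < 3) (r : ZMod k) {i₀ : ℕ} (hi₀ : i₀ < 2 * k + 1) (τ₁ τ₂ : ℕ) :
    ((Finset.univ.filter fun x : Automaton n × Equiv.Perm (Fin n) =>
      IsSingleConfig w M x.1 x.2 q j r i₀ τ₁ τ₂).card : ℝ) ≤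
      Fintype.card (Automaton n) / (n : ℝ) ^ 2 * (n.factorial * (k / (τ₁ + 1))) := by
  have hn : (0 : ℝ) < n := by exact_mod_cast NeZero.pos n
  by_cases hτ : τ₁ ≠ τ₂ ∧ i₀ ≤ τ₂
  swap
  · rw [Finset.filter_false_of_mem]
    · simp only [Finset.card_empty, Nat.cast_zero]; positivity
    · intro x _ hx
      exact hτ ⟨hx.2.2.2.1, hx.2.2.2.2.1⟩
  obtain ⟨hτ, hiτ⟩ := hτ
  set edge := threeWalks w q q (k * j) r M with hedge
  have hkj : k * j ≤ M := by nlinarith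
  set tgt : ℕ → Automaton n → Fin n := fun τ A => if τ = τ₁ then q else walk A w q 0 i₀ with htgt
  have hH := card_fresh_hits_le (isAdaptive_threeWalks (w := w) (q := q) (q' := q) (r := r) hkj)
    tgt {τ₁, τ₂} (by
      intro τ hτm A B hAB
      simp only [htgt]
      split_ifs with h1
      · rfl
      · have h2 : τ = τ₂ := by simpa [h1] using hτm
        exact walk_eq_of_threeWalks hAB (by omega) (by omega))
  rw [Finset.card_pair hτ, ← le_div_iff₀ (by positivity)] at hH
  set H := Finset.univ.filter fun A : Automaton n => ∀ τ ∈ ({τ₁, τ₂} : Finset ℕ),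
    IsFresh edge A τ ∧ endpoint A (edge A τ) = tgt τ A with hHdef
  refine le_trans (card_pairs_le H _ (fun x hx => ?_) fun A _ => ?_)
    (mul_le_mul_of_nonneg_right hH (by positivity))
  · obtain ⟨-, -, -, -, -, h4, h5⟩ := (Finset.mem_filter.1 hx).2
    simp only [hHdef, Finset.mem_filter, Finset.mem_univ, true_and, Finset.mem_insert,
      Finset.mem_singleton, forall_eq_or_imp, forall_eq, htgt, if_true, if_neg hτ.symm]
    exact ⟨h4, h5⟩
  · by_cases hA : q ∈ Function.periodicPts (inducedMap A w) ∧
        τ₁ < k * Function.minimalPeriod (inducedMap A w) q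
    · have h1 := card_isCycleMin_mul_le A w hA.1 2
      have hL := Function.minimalPeriod_pos_of_mem_periodicPts hA.1
      refine ⟨_, ?_, fun σ hσ => Finset.mem_filter.2
        ⟨Finset.mem_univ _, (Finset.mem_filter.1 hσ).2.2.1⟩⟩
      have h2 := inv_le_of_lt_mul hA.2
      set L := Function.minimalPeriod (inducedMap A w) q
      have hL' : (0 : ℝ) < L := by exact_mod_cast hL
      calc _ ≤ (n.factorial : ℝ) / L := by
            rw [le_div_iff₀ hL']
            exact_mod_cast h1
        _ = n.factorial * (1 / L) := by ring
        _ ≤ _ := mul_le_mul_of_nonneg_left h2 (by positivity)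
    · refine ⟨∅, by rw [Finset.card_empty, Nat.cast_zero]; positivity, fun σ hσ => absurd ?_ hA⟩
      have := (Finset.mem_filter.1 hσ).2
      exact ⟨this.1, this.2.2.1⟩

open scoped Classical in
-- Three fresh hits cost `n ^ 3`, and the minima of two disjoint cycles cost the product of their
-- lengths.
lemma card_doubleConfig_le [NeZero n] (w : Word k) {M : ℕ} (hkM : 2 * k ≤ M) (q q' : Fin n)
    {j : ℕ} (hj : j < 3) (r : ZMod k) {i₀ : ℕ} (hi₀ : i₀ < 2 * k + 1) (τ₁ τ₂ τ₃ : ℕ) :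
    ((Finset.univ.filter fun x : Automaton n × Equiv.Perm (Fin n) =>
      IsDoubleConfig w M x.1 x.2 q q' j r i₀ τ₁ τ₂ τ₃).card : ℝ) ≤
      Fintype.card (Automaton n) / (n : ℝ) ^ 3 *
        (n.factorial * ((k / (τ₁ + 1)) * (k / (τ₃ + 1)))) := by
  have hn : (0 : ℝ) < n := by exact_mod_cast NeZero.pos n
  by_cases hτ : τ₁ ≠ τ₂ ∧ τ₁ ≠ M + τ₃ ∧ τ₂ ≠ M + τ₃ ∧ i₀ ≤ τ₂
  swap
  · rw [Finset.filter_false_of_mem]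
    · simp only [Finset.card_empty, Nat.cast_zero]; positivity
    · rintro x - ⟨-, -, -, -, -, -, -, h1, h2, h3, h4, -⟩
      exact hτ ⟨h1, h2, h3, h4⟩
  obtain ⟨hτ₁₂, hτ₁₃, hτ₂₃, hiτ⟩ := hτ
  set edge := threeWalks w q q' (k * j) r M with hedge
  have hkj : k * j ≤ M := by nlinarith
  set tgt : ℕ → Automaton n → Fin n := fun τ A => if τ = τ₁ then q else
    if τ = τ₂ then walk A w q 0 i₀ else q' with htgt
  have hH := card_fresh_hits_le (isAdaptive_threeWalks (w := w) (q := q) (q' := q') (r := r) hkj)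
    tgt {τ₁, τ₂, M + τ₃} (by
      intro τ hτm A B hAB
      simp only [htgt]
      split_ifs with h1 h2
      · rfl
      · exact walk_eq_of_threeWalks hAB (by omega) (by omega)
      · rfl)
  rw [Finset.card_eq_three.2 ⟨τ₁, τ₂, M + τ₃, hτ₁₂, hτ₁₃, hτ₂₃, rfl⟩,
    ← le_div_iff₀ (by positivity)] at hH
  set H := Finset.univ.filter fun A : Automaton n => ∀ τ ∈ ({τ₁, τ₂, M + τ₃} : Finset ℕ),
    IsFresh edge A τ ∧ endpoint A (edge A τ) = tgt τ A with hHdef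
  refine le_trans (card_pairs_le H _ (fun x hx => ?_) fun A _ => ?_)
    (mul_le_mul_of_nonneg_right hH (by positivity))
  · obtain ⟨-, -, -, -, -, -, -, -, -, -, -, h8, h9, h10⟩ := (Finset.mem_filter.1 hx).2
    simp only [hHdef, Finset.mem_filter, Finset.mem_univ, true_and, Finset.mem_insert,
      Finset.mem_singleton, forall_eq_or_imp, forall_eq, htgt, if_true, if_neg hτ₁₂.symm,
      if_neg hτ₁₃.symm, if_neg hτ₂₃.symm]
    exact ⟨h8, h9, h10⟩
  · by_cases hA : q ∈ Function.periodicPts (inducedMap A w) ∧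
      q' ∈ Function.periodicPts (inducedMap A w) ∧ (∀ i, (inducedMap A w)^[i] q ≠ q') ∧
      τ₁ < k * Function.minimalPeriod (inducedMap A w) q ∧
      τ₃ < k * Function.minimalPeriod (inducedMap A w) q'
    · have h1 := card_isCycleMin_isCycleMin_mul_le A w hA.1 hA.2.1 hA.2.2.1 2 1
      have hL := Function.minimalPeriod_pos_of_mem_periodicPts hA.1
      have hL' := Function.minimalPeriod_pos_of_mem_periodicPts hA.2.1
      refine ⟨_, ?_, fun σ hσ => Finset.mem_filter.2 ⟨Finset.mem_univ _,
        And.intro (Finset.mem_filter.1 hσ).2.2.2.2.1 (Finset.mem_filter.1 hσ).2.2.2.2.2.1⟩⟩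
      have h2 := inv_le_of_lt_mul hA.2.2.2.1
      have h3 := inv_le_of_lt_mul hA.2.2.2.2
      set L := Function.minimalPeriod (inducedMap A w) q
      set L' := Function.minimalPeriod (inducedMap A w) q'
      have hLr : (0 : ℝ) < L := by exact_mod_cast hL
      have hLr' : (0 : ℝ) < L' := by exact_mod_cast hL'
      calc _ ≤ (n.factorial : ℝ) / (L * L') := by
            rw [le_div_iff₀ (by positivity)]
            exact_mod_cast h1
        _ = n.factorial * ((1 / L) * (1 / L')) := by field_simp
        _ ≤ _ := mul_le_mul_of_nonneg_left (mul_le_mul h2 h3 (by positivity) (by positivity))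
            (by positivity)
    · refine ⟨∅, by rw [Finset.card_empty, Nat.cast_zero]; positivity, fun σ hσ => absurd ?_ hA⟩
      obtain ⟨h1, h2, h3, -, -, h6, h7, -⟩ := (Finset.mem_filter.1 hσ).2
      exact ⟨h1, h2, h3, h6, h7⟩

open scoped Classical in
lemma card_exists_le {α ι : Type*} [Fintype α] [Fintype ι] (P : ι → α → Prop) :
    ((Finset.univ.filter fun x => ∃ i, P i x).card : ℝ) ≤
      ∑ i, ((Finset.univ.filter fun x => P i x).card : ℝ) := by
  have : (Finset.univ.filter fun x => ∃ i, P i x) =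
      Finset.univ.biUnion fun i => Finset.univ.filter fun x => P i x := by
    ext x; simp
  rw [this]
  exact_mod_cast Finset.card_biUnion_le

/-- The harmonic sum `1 + 1/2 + ⋯ + 1/M`. -/
noncomputable def harmonicSum (M : ℕ) : ℝ := ∑ τ : Fin M, (1 : ℝ) / ((τ : ℕ) + 1)

open scoped Classical in
-- Union bound: the constant `9` combines three values of `j` with `3 * M` values of `τ₂`, and the
-- sum over `τ₁` is harmonic.
lemma card_exists_singleConfig_le [NeZero n] [NeZero k] (w : Word k) {M : ℕ} (hkM : 2 * k ≤ M) :
    ((Finset.univ.filter fun x : Automaton n × Equiv.Perm (Fin n) =>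
      ∃ (q : Fin n) (j : Fin 3) (r : ZMod k) (i₀ : Fin (2 * k + 1)) (τ₁ : Fin M)
        (τ₂ : Fin (3 * M)), IsSingleConfig w M x.1 x.2 q j r i₀ τ₁ τ₂).card : ℝ) ≤
      Fintype.card (Automaton n) * n.factorial *
        (9 * k ^ 2 * (2 * k + 1) * M * harmonicSum M / n) := by
  have hn : (0 : ℝ) < n := by exact_mod_cast NeZero.pos n
  have h1 := card_exists_le (α := Automaton n × Equiv.Perm (Fin n))
    (ι := Fin n × Fin 3 × ZMod k × Fin (2 * k + 1) × Fin M × Fin (3 * M))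
    fun p x => IsSingleConfig w M x.1 x.2 p.1 p.2.1 p.2.2.1 p.2.2.2.1 p.2.2.2.2.1 p.2.2.2.2.2
  simp only [Prod.exists] at h1
  refine h1.trans ((Finset.sum_le_sum fun p _ =>
    card_singleConfig_le w hkM p.1 p.2.1.2 p.2.2.1 p.2.2.2.1.2 _ _).trans_eq ?_)
  simp only [Fintype.sum_prod_type, Finset.sum_const, Finset.card_univ, Fintype.card_fin,
    nsmul_eq_mul, ZMod.card]
  have h2 : ∀ c d : ℝ, ∑ τ : Fin M, d * (c * ((k : ℝ) / ((τ : ℕ) + 1))) =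
      d * c * k * harmonicSum M := by
    intro c d
    rw [harmonicSum, Finset.mul_sum]
    exact Finset.sum_congr rfl fun τ _ => by ring
  rw [← Finset.mul_sum, h2]
  push_cast
  field_simp
  ring

open scoped Classical in
-- Compared with one cycle, the extra base vertex is paid for by the extra hit; the sum over `τ₃`
-- adds a factor `k * harmonicSum M`.
lemma card_exists_doubleConfig_le [NeZero n] [NeZero k] (w : Word k) {M : ℕ} (hkM : 2 * k ≤ M) :
    ((Finset.univ.filter fun x : Automaton n × Equiv.Perm (Fin n) =>
      ∃ (q q' : Fin n) (j : Fin 3) (r : ZMod k) (i₀ : Fin (2 * k + 1)) (τ₁ : Fin M)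
        (τ₂ : Fin (3 * M)) (τ₃ : Fin M),
        IsDoubleConfig w M x.1 x.2 q q' j r i₀ τ₁ τ₂ τ₃).card : ℝ) ≤
      Fintype.card (Automaton n) * n.factorial *
        (9 * k ^ 3 * (2 * k + 1) * M * harmonicSum M ^ 2 / n) := by
  have hn : (0 : ℝ) < n := by exact_mod_cast NeZero.pos n
  have h1 := card_exists_le (α := Automaton n × Equiv.Perm (Fin n))
    (ι := Fin n × Fin n × Fin 3 × ZMod k × Fin (2 * k + 1) × Fin M × Fin (3 * M) × Fin M)
    fun p x => IsDoubleConfig w M x.1 x.2 p.1 p.2.1 p.2.2.1 p.2.2.2.1 p.2.2.2.2.1 p.2.2.2.2.2.1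
      p.2.2.2.2.2.2.1 p.2.2.2.2.2.2.2
  simp only [Prod.exists] at h1
  refine h1.trans ((Finset.sum_le_sum fun p _ =>
    card_doubleConfig_le w hkM p.1 p.2.1 p.2.2.1.2 p.2.2.2.1 p.2.2.2.2.1.2 _ _ _).trans_eq ?_)
  simp only [Fintype.sum_prod_type, Finset.sum_const, Finset.card_univ, Fintype.card_fin,
    nsmul_eq_mul, ZMod.card]
  have h2 : ∀ c d e : ℝ, ∑ τ : Fin M, d * (c * (e * ((k : ℝ) / ((τ : ℕ) + 1)))) =
      d * c * k * harmonicSum M * e := by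
    intro c d e
    rw [harmonicSum, Finset.mul_sum, Finset.sum_mul]
    exact Finset.sum_congr rfl fun τ _ => by ring
  have h3 : ∀ d : ℝ, ∑ τ : Fin M, d * ((k : ℝ) / ((τ : ℕ) + 1)) = d * k * harmonicSum M := by
    intro d
    rw [harmonicSum, Finset.mul_sum]
    exact Finset.sum_congr rfl fun τ _ => by ring
  simp only [h2]
  rw [← Finset.mul_sum, h3]
  push_cast
  field_simp
  ring

open scoped Classical in
lemma card_exists_noRepetition_le [NeZero k] (w : Word k) {a : ℕ} (ha : a < n) :
    ((Finset.univ.filter fun x : Automaton n × Equiv.Perm (Fin n) =>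
      ∃ u r, NoRepetition x.1 w u r (2 * k * (k * a))).card : ℝ) ≤
      Fintype.card (Automaton n) * n.factorial * (n * k * Real.exp (-((a : ℝ) ^ 2 / n))) := by
  have h1 := card_exists_le (α := Automaton n × Equiv.Perm (Fin n)) (ι := Fin n × ZMod k)
    fun p x => NoRepetition x.1 w p.1 p.2 (2 * k * (k * a))
  simp only [Prod.exists] at h1
  refine h1.trans ((Finset.sum_le_sum fun p _ => ?_ : _ ≤ ∑ p : Fin n × ZMod k,
    (Fintype.card (Automaton n) * Real.exp (-((a : ℝ) ^ 2 / n)) * n.factorial : ℝ)).trans_eq ?_)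
  · refine (card_pairs_le (Finset.univ.filter fun A : Automaton n =>
      NoRepetition A w p.1 p.2 (2 * k * (k * a))) (c := n.factorial) _ (fun x hx => ?_)
      fun A _ => ⟨Finset.univ, ?_, fun _ _ => Finset.mem_univ _⟩).trans
      (mul_le_mul_of_nonneg_right (card_noRepetition_le w p.1 p.2 ha) (by positivity))
    · exact Finset.mem_filter.2 ⟨Finset.mem_univ _, (Finset.mem_filter.1 hx).2⟩
    · rw [Finset.card_univ, Fintype.card_perm, Fintype.card_fin]
  · simp only [Finset.sum_const, Finset.card_univ, Fintype.card_prod, Fintype.card_fin, ZMod.card,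
      nsmul_eq_mul]
    push_cast
    ring

/-- The error term of the main estimate. -/
noncomputable def errorTerm (n k a : ℕ) : ℝ :=
  n * k * Real.exp (-((a : ℝ) ^ 2 / n)) +
    18 * (k : ℝ) ^ 3 * (2 * k + 1) * (2 * k * (k * a) : ℕ) *
      (1 + Real.log (2 * k * (k * a) : ℕ)) ^ 2 / n

lemma harmonicSum_le (M : ℕ) : harmonicSum M ≤ 1 + Real.log M := by
  have h := harmonic_le_one_add_log M
  refine le_trans (le_of_eq ?_) h
  rw [harmonicSum, Fin.sum_univ_eq_sum_range (fun i => (1 : ℝ) / ((i : ℝ) + 1)), harmonic]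
  push_cast
  exact Finset.sum_congr rfl fun i _ => by rw [one_div]

lemma one_sub_errorTerm_le [NeZero n] [NeZero k] {w : Word k} (hw : ¬ IsSelfConjugate w) {a : ℕ}
    (ha : a < n) (ha1 : 1 ≤ a) :
    (Fintype.card (Automaton n) * n.factorial : ℝ) * (1 - errorTerm n k a) ≤
      ((cycleGood n w).ncard : ℝ) := by
  classical
  have hk := NeZero.pos k
  have hn : (0 : ℝ) < n := by exact_mod_cast NeZero.pos n
  set M := 2 * k * (k * a) with hM
  have hka : 1 ≤ k * a := Nat.mul_pos hk ha1
  have hkM : 2 * k ≤ M := Nat.le_mul_of_pos_right _ hka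
  set X₁ := Finset.univ.filter fun x : Automaton n × Equiv.Perm (Fin n) =>
      ∃ u r, NoRepetition x.1 w u r M
  set X₂ := Finset.univ.filter fun x : Automaton n × Equiv.Perm (Fin n) =>
      ∃ (q : Fin n) (j : Fin 3) (r : ZMod k) (i₀ : Fin (2 * k + 1)) (τ₁ : Fin M)
        (τ₂ : Fin (3 * M)), IsSingleConfig w M x.1 x.2 q j r i₀ τ₁ τ₂
  set X₃ := Finset.univ.filter fun x : Automaton n × Equiv.Perm (Fin n) =>
      ∃ (q q' : Fin n) (j : Fin 3) (r : ZMod k) (i₀ : Fin (2 * k + 1)) (τ₁ : Fin M)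
        (τ₂ : Fin (3 * M)) (τ₃ : Fin M),
        IsDoubleConfig w M x.1 x.2 q q' j r i₀ τ₁ τ₂ τ₃
  have h₁ : (X₁.card : ℝ) ≤ _ := card_exists_noRepetition_le w ha
  have h₂ : (X₂.card : ℝ) ≤ _ := card_exists_singleConfig_le w hkM
  have h₃ : (X₃.card : ℝ) ≤ _ := card_exists_doubleConfig_le w hkM
  have hcover : (Finset.univ : Finset (Automaton n × Equiv.Perm (Fin n))) ⊆
      (cycleGood n w).toFinset ∪ (X₁ ∪ (X₂ ∪ X₃)) := by
    rintro ⟨A, σ⟩ -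
    by_cases hgood : (A, σ) ∈ cycleGood n w
    · exact Finset.mem_union_left _ (Set.mem_toFinset.2 hgood)
    refine Finset.mem_union_right _ ?_
    by_cases hX : ∃ u r, NoRepetition A w u r M
    · exact Finset.mem_union_left _ (Finset.mem_filter.2 ⟨Finset.mem_univ _, hX⟩)
    refine Finset.mem_union_right _ ?_
    push Not at hX
    rcases exists_config hw hkM hX hgood with h | h
    · exact Finset.mem_union_left _ (Finset.mem_filter.2 ⟨Finset.mem_univ _, h⟩)
    · exact Finset.mem_union_right _ (Finset.mem_filter.2 ⟨Finset.mem_univ _, h⟩)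
  have hcard := (Finset.card_le_card hcover).trans ((Finset.card_union_le _ _).trans
    (Nat.add_le_add_left ((Finset.card_union_le _ _).trans
      (Nat.add_le_add_left (Finset.card_union_le _ _) _)) _))
  rw [Finset.card_univ, Fintype.card_prod, Fintype.card_perm, Fintype.card_fin,
    ← Set.ncard_eq_toFinset_card'] at hcard
  have hcard' : (Fintype.card (Automaton n) * n.factorial : ℝ) ≤
      (cycleGood n w).ncard + (X₁.card + (X₂.card + X₃.card)) := by exact_mod_cast hcard
  have hM1 : (1 : ℝ) ≤ M := by exact_mod_cast (by omega : 1 ≤ M)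
  have hlog : 0 ≤ Real.log M := Real.log_nonneg hM1
  have hharm0 : 0 ≤ harmonicSum M := Finset.sum_nonneg fun _ _ => by positivity
  have hharm := harmonicSum_le M
  set l := 1 + Real.log M with hl
  have hk1 : (1 : ℝ) ≤ k := by exact_mod_cast hk
  have e₂ : 9 * (k : ℝ) ^ 2 * (2 * k + 1) * M * harmonicSum M / n ≤
      9 * (k : ℝ) ^ 3 * (2 * k + 1) * M * l ^ 2 / n := by
    have h1 : harmonicSum M ≤ l ^ 2 := by nlinarith
    have h2 : (k : ℝ) ^ 2 ≤ (k : ℝ) ^ 3 := pow_le_pow_right₀ hk1 (by norm_num)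
    gcongr
  have e₃ : 9 * (k : ℝ) ^ 3 * (2 * k + 1) * M * harmonicSum M ^ 2 / n ≤
      9 * (k : ℝ) ^ 3 * (2 * k + 1) * M * l ^ 2 / n := by
    gcongr
  have herr : errorTerm n k a = n * k * Real.exp (-((a : ℝ) ^ 2 / n)) +
      (9 * (k : ℝ) ^ 3 * (2 * k + 1) * M * l ^ 2 / n +
        9 * (k : ℝ) ^ 3 * (2 * k + 1) * M * l ^ 2 / n) := by
    rw [errorTerm, ← hM, ← hl]
    ring
  have hNf : (0 : ℝ) ≤ Fintype.card (Automaton n) * n.factorial := by positivity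
  have g₂ := h₂.trans (mul_le_mul_of_nonneg_left e₂ hNf)
  have g₃ := h₃.trans (mul_le_mul_of_nonneg_left e₃ hNf)
  rw [herr]
  linarith

end Counting

/-! ### The error term vanishes uniformly -/

open Filter Topology in
-- The exponent `1 / 30` leaves room for `k ^ 6` and a squared logarithm next to `x ^ (2 / 3)`: `6 /
-- 30 + 2 / 30 + 2 / 3 - 1 = -1 / 15`. The exponential bound is `y ^ 6 * exp (-y)` at `y = x ^ (1 /
-- 3)`.
lemma eventually_error_bounds {ε : ℝ} (hε : 0 < ε) : ∀ᶠ x : ℝ in atTop,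
    2 * Real.logb 2 x ≤ x ^ (1 / 30 : ℝ) ∧ 1 + Real.log x ≤ x ^ (1 / 30 : ℝ) ∧
    4 ≤ x ^ (4 / 15 : ℝ) ∧ x ^ 2 * Real.exp (-x ^ (1 / 3 : ℝ)) ≤ ε / 2 ∧
    216 * x ^ (-(1 / 15) : ℝ) ≤ ε / 2 := by
  have hlog := isLittleO_log_rpow_atTop (r := 1 / 30) (by norm_num)
  have hl2 : 0 < Real.log 2 := Real.log_pos (by norm_num)
  have e1 := hlog.bound (c := Real.log 2 / 2) (by positivity)
  have e2 := hlog.bound (c := 1 / 2) (by norm_num)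
  have e3 := (tendsto_rpow_atTop (y := 1 / 30) (by norm_num)).eventually_ge_atTop (2 : ℝ)
  have e4 := (tendsto_rpow_atTop (y := 4 / 15) (by norm_num)).eventually_ge_atTop (4 : ℝ)
  have e5 : Tendsto (fun x : ℝ => x ^ 2 * Real.exp (-x ^ (1 / 3 : ℝ))) atTop (𝓝 0) := by
    have h := (Real.tendsto_pow_mul_exp_neg_atTop_nhds_zero 6).comp
      (tendsto_rpow_atTop (y := 1 / 3) (by norm_num))
    refine h.congr' ?_
    filter_upwards [eventually_ge_atTop 0] with x hx
    simp only [Function.comp]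
    congr 1
    rw [← Real.rpow_natCast, ← Real.rpow_mul hx, ← Real.rpow_natCast]
    norm_num
  have e6 : Tendsto (fun x : ℝ => 216 * x ^ (-(1 / 15) : ℝ)) atTop (𝓝 0) := by
    have h := (tendsto_rpow_neg_atTop (y := 1 / 15) (by norm_num)).const_mul 216
    simpa using h
  filter_upwards [e1, e2, e3, e4, e5.eventually_le_const (by positivity : (0 : ℝ) < ε / 2),
    e6.eventually_le_const (by positivity : (0 : ℝ) < ε / 2), eventually_ge_atTop 1]
    with x h1 h2 h3 h4 h5 h6 hx
  have hlx : 0 ≤ Real.log x := Real.log_nonneg hx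
  have hp : 0 ≤ x ^ (1 / 30 : ℝ) := by positivity
  rw [Real.norm_of_nonneg hlx, Real.norm_of_nonneg hp] at h1 h2
  refine ⟨?_, by linarith, h4, h5, h6⟩
  rw [Real.logb, ← mul_div_assoc, div_le_iff₀ hl2]
  linarith

/-- The choice `a = ⌈n ^ (2 / 3)⌉` gives `a ^ 2 / n ≥ n ^ (1 / 3)`, which beats `n * k`, while `k ^
6 * a * log ^ 2` stays below `n`. -/
lemma exists_errorTerm_le {ε : ℝ} (hε : 0 < ε) : ∃ N : ℕ, ∀ n : ℕ, N ≤ n → ∀ k : ℕ, 1 ≤ k →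
    (k : ℝ) ≤ 2 * Real.logb 2 (n : ℝ) →
    ∃ a, 1 ≤ a ∧ a < n ∧ errorTerm n k a ≤ ε := by
  obtain ⟨x₀, hx₀⟩ := Filter.eventually_atTop.1 (eventually_error_bounds hε)
  refine ⟨max 2 ⌈x₀⌉₊, fun n hn k hk hkn => ?_⟩
  have hn2 : 2 ≤ n := (le_max_left _ _).trans hn
  obtain ⟨h1, h2, h3, h4, h5⟩ := hx₀ n (Nat.ceil_le.1 ((le_max_right _ _).trans hn))
  set x : ℝ := (n : ℝ) with hx
  have hx1 : (1 : ℝ) ≤ x := by rw [hx]; exact_mod_cast (by omega : 1 ≤ n)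
  have hx0 : 0 < x := by linarith
  have hkx : (k : ℝ) ≤ x ^ (1 / 30 : ℝ) := hkn.trans h1
  have hk1 : (1 : ℝ) ≤ k := by exact_mod_cast hk
  set p : ℝ := x ^ (2 / 3 : ℝ) with hp
  have hp1 : 1 ≤ p := Real.one_le_rpow hx1 (by norm_num)
  set a := ⌈p⌉₊ with ha
  have hap : p ≤ a := Nat.le_ceil p
  have ha2 : (a : ℝ) ≤ 2 * p := by
    have := Nat.ceil_lt_add_one (by linarith : 0 ≤ p)
    linarith
  have hxy : ∀ y z : ℝ, x ^ y * x ^ z = x ^ (y + z) := fun y z => (Real.rpow_add hx0 y z).symm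
  have hpow : ∀ (y : ℝ) (m : ℕ), (x ^ y) ^ m = x ^ (y * m) := fun y m => by
    rw [← Real.rpow_natCast, ← Real.rpow_mul hx0.le]
  have h3' : 4 * p ≤ x ^ (14 / 15 : ℝ) := by
    calc 4 * p ≤ x ^ (4 / 15 : ℝ) * p := mul_le_mul_of_nonneg_right h3 (by linarith)
      _ = x ^ (14 / 15 : ℝ) := by rw [hp, hxy]; norm_num
  have hle : x ^ (14 / 15 : ℝ) ≤ x := by
    calc x ^ (14 / 15 : ℝ) ≤ x ^ (1 : ℝ) := Real.rpow_le_rpow_of_exponent_le hx1 (by norm_num)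
      _ = x := Real.rpow_one x
  have han : a < n := by
    have : (a : ℝ) < n := by rw [← hx]; linarith
    exact_mod_cast this
  have hk2 : (k : ℝ) ^ 2 ≤ x ^ (1 / 15 : ℝ) := by
    calc (k : ℝ) ^ 2 ≤ (x ^ (1 / 30 : ℝ)) ^ 2 := pow_le_pow_left₀ (by linarith) hkx 2
      _ = x ^ (1 / 15 : ℝ) := by rw [hpow]; norm_num
  have hMcast : ((2 * k * (k * a) : ℕ) : ℝ) = 2 * (k : ℝ) ^ 2 * a := by push_cast; ring
  have hM : 2 * (k : ℝ) ^ 2 * a ≤ 4 * (k : ℝ) ^ 2 * p := by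
    nlinarith [mul_le_mul_of_nonneg_left ha2 (by positivity : (0 : ℝ) ≤ 2 * (k : ℝ) ^ 2)]
  have hMx : 2 * (k : ℝ) ^ 2 * a ≤ x := by
    calc 2 * (k : ℝ) ^ 2 * a ≤ 4 * (k : ℝ) ^ 2 * p := hM
      _ = (k : ℝ) ^ 2 * (4 * p) := by ring
      _ ≤ x ^ (1 / 15 : ℝ) * x ^ (14 / 15 : ℝ) := mul_le_mul hk2 h3' (by linarith) (by positivity)
      _ = x := by rw [hxy]; norm_num
  have ha1 : (1 : ℝ) ≤ a := hp1.trans hap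
  have hMpos : (1 : ℝ) ≤ 2 * (k : ℝ) ^ 2 * a := by nlinarith [one_le_pow₀ (n := 2) hk1]
  have hlog : (1 + Real.log (2 * (k : ℝ) ^ 2 * a)) ^ 2 ≤ x ^ (1 / 15 : ℝ) := by
    have hl0 := Real.log_nonneg hMpos
    have hl := Real.log_le_log (by linarith) hMx
    calc _ ≤ (x ^ (1 / 30 : ℝ)) ^ 2 := pow_le_pow_left₀ (by linarith) (by linarith) 2
      _ = x ^ (1 / 15 : ℝ) := by rw [hpow]; norm_num
  refine ⟨a, by exact_mod_cast ha1, han, ?_⟩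
  have t1 : x * k * Real.exp (-((a : ℝ) ^ 2 / x)) ≤ ε / 2 := by
    refine le_trans ?_ h4
    have hkx' : (k : ℝ) ≤ x := by
      refine hkx.trans ?_
      calc x ^ (1 / 30 : ℝ) ≤ x ^ (1 : ℝ) := Real.rpow_le_rpow_of_exponent_le hx1 (by norm_num)
        _ = x := Real.rpow_one x
    have hexp : x ^ (1 / 3 : ℝ) ≤ (a : ℝ) ^ 2 / x := by
      rw [le_div_iff₀ hx0]
      calc x ^ (1 / 3 : ℝ) * x = p ^ 2 := by
            nth_rewrite 2 [← Real.rpow_one x]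
            rw [hxy, hp, hpow]; norm_num
        _ ≤ (a : ℝ) ^ 2 := pow_le_pow_left₀ (by linarith) hap 2
    have : Real.exp (-((a : ℝ) ^ 2 / x)) ≤ Real.exp (-x ^ (1 / 3 : ℝ)) :=
      Real.exp_le_exp.2 (by linarith)
    exact mul_le_mul (by nlinarith) this (Real.exp_pos _).le (by positivity)
  have t2 : 18 * (k : ℝ) ^ 3 * (2 * k + 1) * (2 * (k : ℝ) ^ 2 * a) *
      (1 + Real.log (2 * (k : ℝ) ^ 2 * a)) ^ 2 / x ≤ ε / 2 := by
    refine le_trans ?_ h5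
    have h6 : 18 * (k : ℝ) ^ 3 * (2 * k + 1) ≤ 54 * (k : ℝ) ^ 4 := by
      have : (k : ℝ) ^ 3 * (2 * k + 1) ≤ (k : ℝ) ^ 3 * (3 * k) :=
        mul_le_mul_of_nonneg_left (by linarith) (by positivity)
      nlinarith
    have hk6 : (k : ℝ) ^ 6 ≤ x ^ (1 / 5 : ℝ) := by
      calc (k : ℝ) ^ 6 ≤ (x ^ (1 / 30 : ℝ)) ^ 6 := pow_le_pow_left₀ (by linarith) hkx 6
        _ = x ^ (1 / 5 : ℝ) := by rw [hpow]; norm_num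
    rw [div_le_iff₀ hx0]
    calc 18 * (k : ℝ) ^ 3 * (2 * k + 1) * (2 * (k : ℝ) ^ 2 * a) *
        (1 + Real.log (2 * (k : ℝ) ^ 2 * a)) ^ 2
        ≤ 54 * (k : ℝ) ^ 4 * (4 * (k : ℝ) ^ 2 * p) * x ^ (1 / 15 : ℝ) :=
          mul_le_mul (mul_le_mul h6 hM (by positivity) (by positivity)) hlog (by positivity)
            (by positivity)
      _ = 216 * ((k : ℝ) ^ 6 * (p * x ^ (1 / 15 : ℝ))) := by ring
      _ ≤ 216 * (x ^ (1 / 5 : ℝ) * (p * x ^ (1 / 15 : ℝ))) := by gcongr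
      _ = 216 * x ^ (-(1 / 15) : ℝ) * x := by
          have e : x ^ (-(1 / 15) : ℝ) * x = x ^ (14 / 15 : ℝ) := by
            calc _ = x ^ (-(1 / 15) : ℝ) * x ^ (1 : ℝ) := by rw [Real.rpow_one]
              _ = _ := by rw [hxy]; norm_num
          rw [mul_assoc 216, e, hp, hxy, hxy]
          norm_num
  rw [errorTerm, hMcast, ← hx]
  linarith

/-! ### The main theorem -/

/-- The two injections squeeze the ratio between `1 - errorTerm n k a` and `1`. -/
lemma abs_ratio_sub_one_le {n k : ℕ} [NeZero n] [NeZero k] {w : Word k} (hw : ¬ IsSelfConjugate w)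
    {a : ℕ} (ha1 : 1 ≤ a) (ha : a < n) {ε : ℝ} (hε : errorTerm n k a ≤ ε) :
    |((goodMarkedTrees n w).ncard : ℝ) /
      ((Nat.card (MarkedLabelledAutomaton n) : ℝ) / (n : ℝ)) - 1| ≤ ε := by
  have hn : (0 : ℝ) < n := by exact_mod_cast NeZero.pos n
  set D : ℝ := Fintype.card (Automaton n) * n.factorial with hD
  have hDpos : 0 < D := by
    have : 0 < Fintype.card (Automaton n) := Fintype.card_pos
    positivity
  have hcard : (Nat.card (MarkedLabelledAutomaton n) : ℝ) / n = D := by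
    rw [Nat.card_eq_fintype_card, Fintype.card_prod, Fintype.card_prod, Fintype.card_perm,
      Fintype.card_fin, hD]
    push_cast
    field_simp
  have hup : ((goodMarkedTrees n w).ncard : ℝ) ≤ D := by
    have h := ncard_goodMarkedTrees_le (n := n) w
    rw [Nat.card_eq_fintype_card, Fintype.card_prod, Fintype.card_perm, Fintype.card_fin] at h
    rw [hD]
    exact_mod_cast h
  have hlow : D * (1 - errorTerm n k a) ≤ ((goodMarkedTrees n w).ncard : ℝ) :=
    (one_sub_errorTerm_le hw ha ha1).trans (by exact_mod_cast ncard_cycleGood_le w)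
  rw [hcard, abs_le]
  have h1 : ((goodMarkedTrees n w).ncard : ℝ) / D ≤ 1 := (div_le_one hDpos).2 hup
  have h2 : 1 - errorTerm n k a ≤ ((goodMarkedTrees n w).ncard : ℝ) / D := by
    rw [le_div_iff₀ hDpos, mul_comm]
    exact hlow
  have h3 : 0 ≤ errorTerm n k a := by linarith
  constructor <;> linarith

theorem mainTheorem7 :
    ∀ ε : ℝ, 0 < ε → ∃ N : ℕ, ∀ n : ℕ, N ≤ n → ∀ k : ℕ, 1 ≤ k →
      (k : ℝ) ≤ 2 * Real.logb 2 (n : ℝ) → ∀ w : Word k, ¬ IsSelfConjugate w →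
        |((goodMarkedTrees n w).ncard : ℝ) /
            ((Nat.card (MarkedLabelledAutomaton n) : ℝ) / (n : ℝ)) - 1| ≤ ε ∧
        |uniformProb (goodMarkedTrees n w) / (1 / (n : ℝ)) - 1| ≤ ε := by
  intro ε hε
  obtain ⟨N, hN⟩ := exists_errorTerm_le hε
  refine ⟨N, fun n hn k hk hkn w hw => ?_⟩
  obtain ⟨a, ha1, han, herr⟩ := hN n hn k hk hkn
  have : NeZero n := ⟨by omega⟩
  have : NeZero k := ⟨by omega⟩
  have h := abs_ratio_sub_one_le hw ha1 han herr
  refine ⟨h, ?_⟩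
  have e : uniformProb (goodMarkedTrees n w) / (1 / (n : ℝ)) = ((goodMarkedTrees n w).ncard : ℝ) /
      ((Nat.card (MarkedLabelledAutomaton n) : ℝ) / (n : ℝ)) := by
    rw [uniformProb, div_div_div_eq, mul_one, div_div_eq_mul_div, mul_div_assoc]
  rw [e]
  exact h
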